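/- Let $\{S_k;k\ge 1\}$ be a nondecreasing sequence of positive random variables, and put $S_0=0$. Suppose there exist a standard Wiener process $\{W(t);t\ge 0\}$ (possibly on another probability space) and two positive constants $\mu$ and $\sigma$ such that $$W_n(t):=\frac{S_{[nt]}-[nt]\mu}{\sigma\sqrt n}\ \overset{\mathscr D}{\to}\ W(t)\quad\text{in } D[0,1],\ \text{ as } n\to\infty,$$ and $$\sup_{n\ge 1}\frac{E|S_n-n\mu|}{\sqrt n}<\infty .$$ Here $D[0,1]$ is the space of right-continuous functions on $[0,1]$ with left limits, with the Skorokhod ($J_1$) topology, and $\overset{\mathscr D}{\to}$ is weak convergence of laws. Then, with $\gamma=\mu/\sigma$, the function $x\mapsto W(x)/x$ is almost surely integrable on $(0,1]$ and $$\left(\prod_{k=1}^{[nt]}\frac{S_k}{k\mu}\right)^{\gamma/\sqrt n}\ \overset{\mathscr D}{\to}\ \exp\left\{\int_0^t\frac{W(x)}{x}\,dx\right\}\quad\text{in } D[0,1],\ \text{ as } n\to\infty .$$ In particular, for $t=1$, $$\left(\prod_{k=1}^{n}\frac{S_k}{k\mu}\right)^{\gamma/\sqrt n}\ \overset{\mathscr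 D}{\to}\ e^{\sqrt2\,N(0,1)},$$ where $N(0,1)$ is a standard normal random variable. -/

import Mathlib

open MeasureTheory ProbabilityTheory Filter Topology
open scoped NNReal ENNReal

/-- A function `[0,1] → ℝ` is càdlàg if it is right-continuous and has (finite) left limits.
(At `t = 0` the filter `𝓝[<] t` is trivial, so no left limit is required there.) -/
def IsCadlag (f : unitInterval → ℝ) : Prop :=
  ∀ t : unitInterval, ContinuousWithinAt f (Set.Ici t) t ∧ ∃ l : ℝ, Tendsto f (𝓝[<] t) (𝓝 l)

/-- The set `D[0,1]` of càdlàg functions on `[0,1]`. -/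
structure SkorokhodSpace where
  toFun : unitInterval → ℝ
  cadlag : IsCadlag toFun

namespace SkorokhodSpace

instance : CoeFun SkorokhodSpace (fun _ => unitInterval → ℝ) := ⟨toFun⟩

/-- The cost of matching `x` with `y` through the time change `l`:
`max (sup_t |l(t) - t|) (sup_t |x(t) - y(l(t))|)`. -/
noncomputable def cost (x y : SkorokhodSpace) (l : unitInterval ≃o unitInterval) : ℝ≥0∞ :=
  max (⨆ t, edist (l t) t) (⨆ t, edist (x t) (y (l t)))

/-- The Skorokhod (J₁) distance: the infimum of the matching cost over all time changes, i.e. over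
all increasing bijections of `[0,1]`, which are automatically homeomorphisms. -/
noncomputable def dist (x y : SkorokhodSpace) : ℝ≥0∞ := ⨅ l : unitInterval ≃o unitInterval, cost x y l

theorem dist_self (x : SkorokhodSpace) : dist x x = 0 := by
  refine le_antisymm (iInf_le_of_le (OrderIso.refl unitInterval) ?_) bot_le
  simp [cost]

theorem dist_le_symm (x y : SkorokhodSpace) : dist x y ≤ dist y x := by
  refine le_iInf fun l => iInf_le_of_le l.symm (max_le_max ?_ ?_)
  · refine iSup_le fun t => le_iSup_of_le (l.symm t) ?_
    rw [l.apply_symm_apply, edist_comm]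
  · refine iSup_le fun t => le_iSup_of_le (l.symm t) ?_
    rw [l.apply_symm_apply, edist_comm]

theorem dist_triangle (x y z : SkorokhodSpace) : dist x z ≤ dist x y + dist y z := by
  unfold dist
  simp_rw [ENNReal.iInf_add, ENNReal.add_iInf]
  refine le_iInf fun l => le_iInf fun m => iInf_le_of_le (l.trans m) (max_le ?_ ?_)
  · refine iSup_le fun t => ?_
    calc edist (m (l t)) t ≤ edist (m (l t)) (l t) + edist (l t) t := edist_triangle _ _ _
      _ = edist (l t) t + edist (m (l t)) (l t) := add_comm _ _
      _ ≤ cost x y l + cost y z m := add_le_add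
          (le_max_of_le_left (le_iSup (fun t => edist (l t) t) t))
          (le_max_of_le_left (le_iSup (fun t => edist (m t) t) (l t)))
  · refine iSup_le fun t => ?_
    calc edist (x t) (z (m (l t)))
        ≤ edist (x t) (y (l t)) + edist (y (l t)) (z (m (l t))) := edist_triangle _ _ _
      _ ≤ cost x y l + cost y z m := add_le_add
          (le_max_of_le_right (le_iSup (fun t => edist (x t) (y (l t))) t))
          (le_max_of_le_right (le_iSup (fun t => edist (y t) (z (m t))) (l t)))

/-- `D[0,1]` carries the topology of the Skorokhod distance. -/
noncomputable instance : PseudoEMetricSpace SkorokhodSpace where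
  edist := dist
  edist_self := dist_self
  edist_comm x y := le_antisymm (dist_le_symm x y) (dist_le_symm y x)
  edist_triangle := dist_triangle

/-- `D[0,1]` carries the Borel σ-algebra of the Skorokhod topology. -/
noncomputable instance : MeasurableSpace SkorokhodSpace := borel SkorokhodSpace

instance : BorelSpace SkorokhodSpace := ⟨rfl⟩

end SkorokhodSpace

/-- Convergence in distribution in `D[0,1]` of the real processes `X n` (with time set `[0,1]`) to
the process `Z`: almost all paths of these processes are càdlàg, and, viewed as random elements of
`D[0,1]`, the processes `X n` converge in distribution (weak convergence of laws) to `Z`. The limit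
may live on a probability space of its own. -/
def ConvergesInDistributionInD {Ω Ω' : Type*} [MeasurableSpace Ω] [MeasurableSpace Ω']
    (X : ℕ → Ω → unitInterval → ℝ) (Z : Ω' → unitInterval → ℝ)
    (P : Measure Ω) [IsProbabilityMeasure P] (Q : Measure Ω') [IsProbabilityMeasure Q] : Prop :=
  ∃ (X' : ℕ → Ω → SkorokhodSpace) (Z' : Ω' → SkorokhodSpace),
    (∀ n, ∀ᵐ ω ∂P, ∀ t, X' n ω t = X n ω t) ∧
    (∀ᵐ ω ∂Q, ∀ t, Z' ω t = Z ω t) ∧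
    TendstoInDistribution X' atTop Z' (fun _ => P) Q

/-- The process `W_n(t) = (S_{[nt]} - [nt] μ) / (σ √n)`, `0 ≤ t ≤ 1`. -/
noncomputable def rescaledProcess {Ω : Type*} (S : ℕ → Ω → ℝ) (μ σ : ℝ)
    (n : ℕ) (ω : Ω) (t : unitInterval) : ℝ :=
  (S ⌊(n : ℝ) * t⌋₊ ω - (⌊(n : ℝ) * t⌋₊ : ℝ) * μ) / (σ * √(n : ℝ))

/-- The process `t ↦ (∏_{k=1}^{[nt]} S_k / (k μ)) ^ (γ / √n)`, `0 ≤ t ≤ 1`. -/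
noncomputable def productProcess {Ω : Type*} (S : ℕ → Ω → ℝ) (μ γ : ℝ)
    (n : ℕ) (ω : Ω) (t : unitInterval) : ℝ :=
  (∏ k ∈ Finset.Icc 1 ⌊(n : ℝ) * t⌋₊, S k ω / ((k : ℝ) * μ)) ^ (γ / √(n : ℝ))

/-! Put `γ = μ / σ`. The logarithm of the product process is `γ/√n ∑ log (S_k/(kμ))` over `k ≤
[nt]`. Replacing `log y` by `y - 1` turns it into `∑ W_n(k/n)/k`, a Riemann sum for `∫_0^t W_n(x)/x
dx`, so the limit should be `∫_0^t W(x)/x dx`.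

Two points need care. The weight `1/x` is singular at `0`, so weak convergence of `W_n` does not
pass directly to these sums. With `1/max x ε` instead, the Riemann sums converge continuously at
continuous paths (`tendsto_riem`), and the extended continuous mapping theorem applies. The moment
hypothesis gives `E|W_n(k/n)| ≤ C√(k/n)`, hence a truncation error of mean `O(√ε)` uniformly in `n`,
and a converging-together argument lets `ε → 0` (`tendstoInDistribution_riem_zero`). The same moment
bound for `W` makes `W(x)/x` integrable.

For the linearization, monotonicity and the moment bound yield `S_k/(kμ) → 1` almost surely, so
eventually each error is at most `κ|S_k/(kμ) - 1|` with `κ` arbitrarily small. The normalized sums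
of these deviations are bounded in mean, so the total error vanishes in probability
(`eventually_measure_sum_log_error_le`).

Exponentiation is continuous at continuous paths, which gives the functional limit. At `t = 1` the
integral is the limit in law of Gaussian sums with variance `2 - H_n/n → 2`, where `H_n` is the
harmonic sum (`map_primD_zero_one`). -/

/-! ### General tools for convergence in distribution. -/

section WeakConvergence

variable {Ω Ω' E E' : Type*} [MeasurableSpace Ω] [MeasurableSpace Ω']
  {P : Measure Ω} [IsProbabilityMeasure P] {Q : Measure Ω'} [IsProbabilityMeasure Q]
  [MeasurableSpace E] [MeasurableSpace E']

theorem tendstoInDistribution_of_forall_isClosed [TopologicalSpace E] [OpensMeasurableSpace E]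
    {X : ℕ → Ω → E} {Z : Ω' → E}
    (hX : ∀ n, AEMeasurable (X n) P) (hZ : AEMeasurable Z Q)
    (h : ∀ F : Set E, IsClosed F →
      limsup (fun n => P (X n ⁻¹' F)) atTop ≤ Q (Z ⁻¹' F)) :
    TendstoInDistribution X atTop Z (fun _ => P) Q where
  forall_aemeasurable := hX
  aemeasurable_limit := hZ
  tendsto := by
    refine tendsto_of_forall_isClosed_limsup_le' fun F hF => ?_
    simp only [ProbabilityMeasure.coe_mk]
    rw [Measure.map_apply_of_aemeasurable hZ hF.measurableSet]
    simp_rw [Measure.map_apply_of_aemeasurable (hX _) hF.measurableSet]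
    exact h F hF

theorem MeasureTheory.TendstoInDistribution.limsup_isClosed_le [TopologicalSpace E]
    [OpensMeasurableSpace E] [HasOuterApproxClosed E] {X : ℕ → Ω → E} {Z : Ω' → E}
    (h : TendstoInDistribution X atTop Z (fun _ => P) Q) {F : Set E} (hF : IsClosed F) :
    limsup (fun n => P (X n ⁻¹' F)) atTop ≤ Q (Z ⁻¹' F) := by
  have := ProbabilityMeasure.limsup_measure_closed_le_of_tendsto h.tendsto hF
  simp only [ProbabilityMeasure.coe_mk] at this
  rw [Measure.map_apply_of_aemeasurable h.aemeasurable_limit hF.measurableSet] at this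
  simpa only [Measure.map_apply_of_aemeasurable (h.forall_aemeasurable _) hF.measurableSet]
    using this

/-- **Extended continuous mapping theorem**: the maps may vary with the index, and continuous
convergence is only needed at almost every value of the limit. -/
theorem MeasureTheory.TendstoInDistribution.extended_continuous_mapping [TopologicalSpace E]
    [OpensMeasurableSpace E] [HasOuterApproxClosed E] [TopologicalSpace E']
    [OpensMeasurableSpace E'] {X : ℕ → Ω → E} {Z : Ω' → E} {h : ℕ → E → E'} {T : Ω' → E'}
    (hXZ : TendstoInDistribution X atTop Z (fun _ => P) Q)
    (hX : ∀ n, AEMeasurable (fun ω => h n (X n ω)) P) (hT : AEMeasurable T Q)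
    (hh : ∀ᵐ ω ∂Q, Tendsto (fun p : ℕ × E => h p.1 p.2) (atTop ×ˢ 𝓝 (Z ω)) (𝓝 (T ω))) :
    TendstoInDistribution (fun n ω => h n (X n ω)) atTop T (fun _ => P) Q := by
  refine tendstoInDistribution_of_forall_isClosed hX hT fun F hF => ?_
  -- `G k` is a closed set containing `h m ⁻¹' F` for every `m ≥ k`, so the portmanteau bound for
  -- `Z` applies to it. It remains to see that lying in every `G k` forces `T ω ∈ F` almost surely.
  set G : ℕ → Set E := fun k => closure (⋃ m ≥ k, h m ⁻¹' F) with hG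
  have hGm : ∀ k, NullMeasurableSet (Z ⁻¹' G k) Q := fun k =>
    hXZ.aemeasurable_limit.nullMeasurableSet_preimage isClosed_closure.measurableSet
  have hanti : Antitone fun k => Z ⁻¹' G k := by
    intro k l hkl
    refine Set.preimage_mono (closure_mono ?_)
    exact Set.biUnion_subset_biUnion_left fun m (hm : l ≤ m) => hkl.trans hm
  have hle : ∀ k, limsup (fun n => P ((fun ω => h n (X n ω)) ⁻¹' F)) atTop ≤ Q (Z ⁻¹' G k) := by
    intro k
    refine le_trans ?_ (hXZ.limsup_isClosed_le isClosed_closure)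
    refine limsup_le_limsup ?_
    filter_upwards [eventually_ge_atTop k] with n hn
    refine measure_mono fun ω hω => subset_closure ?_
    exact Set.mem_biUnion (show n ∈ {m | m ≥ k} from hn) hω
  have hlim := tendsto_measure_iInter_atTop hGm hanti ⟨0, measure_ne_top _ _⟩
  refine (ge_of_tendsto' hlim hle).trans (measure_mono_ae ?_)
  filter_upwards [hh] with ω hω hmem
  by_contra hnot
  -- If `T ω ∉ F`, continuous convergence gives a neighbourhood of `Z ω` on which all late `h m`
  -- avoid `F`, so `Z ω` is outside some `G k`.
  have hev := hω.eventually (hF.isOpen_compl.mem_nhds hnot)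
  obtain ⟨s, hs, U, hU, hsU⟩ := mem_prod_iff.1 hev
  obtain ⟨k, hk⟩ := mem_atTop_sets.1 hs
  have hmem' : Z ω ∈ G k := Set.mem_iInter.1 hmem k
  obtain ⟨x, hxU, hx⟩ := mem_closure_iff_nhds.1 hmem' U hU
  obtain ⟨m, hm, hxm⟩ := Set.mem_iUnion₂.1 hx
  exact hsU (Set.mk_mem_prod (hk m hm) hxU) hxm

/-- **Converging together**: if `A m n` converges in distribution to `B m` as `n → ∞`, `B m → T`
almost surely as `m → ∞`, and `A m n` is close to `X n` in probability, uniformly in large `n`, when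
`m` is large, then `X n` converges in distribution to `T`. -/
theorem tendstoInDistribution_of_converging_together [PseudoEMetricSpace E] [BorelSpace E]
    {A : ℕ → ℕ → Ω → E} {X : ℕ → Ω → E} {B : ℕ → Ω' → E} {T : Ω' → E}
    (hA : ∀ m, TendstoInDistribution (A m) atTop (B m) (fun _ => P) Q)
    (hX : ∀ n, AEMeasurable (X n) P) (hT : AEMeasurable T Q)
    (hB : ∀ᵐ ω ∂Q, Tendsto (fun m => B m ω) atTop (𝓝 (T ω)))
    (hAX : ∀ δ > 0, ∀ η > 0, ∀ᶠ m in atTop, ∀ᶠ n in atTop,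
      P {ω | ENNReal.ofReal δ < edist (X n ω) (A m n ω)} ≤ ENNReal.ofReal η) :
    TendstoInDistribution X atTop T (fun _ => P) Q := by
  have hBT : TendstoInDistribution B atTop T (fun _ => Q) Q :=
    tendstoInDistribution_of_ae_tendsto (fun m => (hA m).aemeasurable_limit) hT hB
  refine tendstoInDistribution_of_forall_isClosed hX hT fun F hF => ?_
  -- The thickening absorbs discrepancies up to `δ`; larger ones have probability at most `η`.
  -- Portmanteau is then used twice, for `n → ∞` and for `m → ∞`, and finally `δ → 0`.
  have key : ∀ δ > 0, limsup (fun n => P (X n ⁻¹' F)) atTop ≤ Q (T ⁻¹' Metric.cthickening δ F) := by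
    intro δ hδ
    refine ENNReal.le_of_forall_pos_le_add fun η hη _ => ?_
    have h1 : ∀ᶠ m in atTop, limsup (fun n => P (X n ⁻¹' F)) atTop ≤
        Q (B m ⁻¹' Metric.cthickening δ F) + η := by
      filter_upwards [hAX δ hδ η hη] with m hm
      calc limsup (fun n => P (X n ⁻¹' F)) atTop
          ≤ limsup (fun n => P (A m n ⁻¹' Metric.cthickening δ F) + η) atTop := by
            refine limsup_le_limsup ?_
            filter_upwards [hm] with n hn
            refine (measure_mono (t := A m n ⁻¹' Metric.cthickening δ F ∪
              {ω | ENNReal.ofReal δ < edist (X n ω) (A m n ω)}) fun ω hω => ?_).trans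
              ((measure_union_le _ _).trans (add_le_add le_rfl (by simpa using hn)))
            by_cases hc : ENNReal.ofReal δ < edist (X n ω) (A m n ω)
            · exact Or.inr hc
            · refine Or.inl (Metric.mem_cthickening_of_edist_le _ _ _ _ hω ?_)
              rw [edist_comm]
              exact not_lt.1 hc
        _ = limsup (fun n => P (A m n ⁻¹' Metric.cthickening δ F)) atTop + η := by
            exact limsup_add_const atTop _ _ (by isBoundedDefault) (by isBoundedDefault)
        _ ≤ _ := by
            gcongr
            exact (hA m).limsup_isClosed_le Metric.isClosed_cthickening
    calc limsup (fun n => P (X n ⁻¹' F)) atTop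
        ≤ limsup (fun m => Q (B m ⁻¹' Metric.cthickening δ F) + η) atTop :=
          le_limsup_of_frequently_le h1.frequently
      _ = limsup (fun m => Q (B m ⁻¹' Metric.cthickening δ F)) atTop + η := by
          exact limsup_add_const atTop _ _ (by isBoundedDefault) (by isBoundedDefault)
      _ ≤ _ := by
          gcongr
          exact hBT.limsup_isClosed_le Metric.isClosed_cthickening
  have hlim := tendsto_measure_cthickening_of_isClosed (μ := Q.map T) (s := F)
    ⟨1, one_pos, by
      have := Measure.isProbabilityMeasure_map hT (μ := Q)
      exact measure_ne_top _ _⟩ hF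
  rw [Measure.map_apply_of_aemeasurable hT hF.measurableSet] at hlim
  have hlim' := hlim.mono_left (nhdsWithin_le_nhds (s := Set.Ioi 0))
  refine ge_of_tendsto hlim' ?_
  filter_upwards [self_mem_nhdsWithin] with δ hδ
  rw [Measure.map_apply_of_aemeasurable hT Metric.isClosed_cthickening.measurableSet]
  exact key δ hδ

end WeakConvergence

/-! ### The Skorokhod topology near continuous paths, and step functions. -/

namespace SkorokhodSpace

theorem edist_le_of_forall {x y : SkorokhodSpace} {r : ℝ≥0∞} (h : ∀ t, edist (x t) (y t) ≤ r) :
    edist x y ≤ r := by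
  refine (iInf_le _ (OrderIso.refl unitInterval)).trans ?_
  refine max_le (iSup_le fun t => ?_) (iSup_le fun t => h t)
  simp

theorem edist_le_ofReal {x y : SkorokhodSpace} {r : ℝ} (h : ∀ t, |x t - y t| ≤ r) :
    edist x y ≤ ENNReal.ofReal r :=
  edist_le_of_forall fun t => by
    rw [edist_dist, Real.dist_eq]
    exact ENNReal.ofReal_le_ofReal (h t)

theorem tendsto_of_forall_abs_sub_le {ι : Type*} {l : Filter ι} {x : ι → SkorokhodSpace}
    {y : SkorokhodSpace} (h : ∀ η > 0, ∀ᶠ i in l, ∀ t, |x i t - y t| ≤ η) :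
    Tendsto x l (𝓝 y) := by
  rw [EMetric.tendsto_nhds]
  intro ε hε
  obtain ⟨η, hη, hηε⟩ : ∃ η : ℝ, 0 < η ∧ ENNReal.ofReal η < ε := by
    obtain ⟨q, hq, hqε⟩ := ENNReal.lt_iff_exists_real_btwn.1 hε
    exact ⟨q, by simpa using hqε.1, hqε.2⟩
  filter_upwards [h η hη] with i hi
  exact (edist_le_ofReal hi).trans_lt hηε

/-- Near a continuous function, convergence in the Skorokhod topology is uniform. -/
theorem eventually_forall_abs_sub_lt {z : SkorokhodSpace} (hz : Continuous z) {η : ℝ} (hη : 0 < η) :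
    ∀ᶠ x in 𝓝 z, ∀ t, |x t - z t| < η := by
  have huc := CompactSpace.uniformContinuous_of_continuous hz
  obtain ⟨δ, hδ, hδz⟩ := Metric.uniformContinuous_iff.1 huc (η / 2) (half_pos hη)
  -- `δ` bounds the time shift, so that uniform continuity of `z` absorbs it; `η / 2` bounds the
  -- mismatch after the time change.
  set r := min δ (η / 2)
  have hr : 0 < r := lt_min hδ (half_pos hη)
  filter_upwards [Metric.eball_mem_nhds z (ENNReal.ofReal_pos.2 hr)] with x hx t
  obtain ⟨l, hl⟩ := iInf_lt_iff.1 (show (⨅ l, cost x z l) < ENNReal.ofReal r from hx)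
  obtain ⟨h1, h2⟩ := max_lt_iff.1 hl
  have h1t := (le_iSup (fun t => edist (l t) t) t).trans_lt h1
  have h2t := (le_iSup (fun t => edist (x t) (z (l t))) t).trans_lt h2
  rw [edist_dist, ENNReal.ofReal_lt_ofReal_iff hr] at h1t h2t
  have h3 := hδz (h1t.trans_le (min_le_left _ _))
  rw [Real.dist_eq] at h2t h3
  calc |x t - z t| ≤ |x t - z (l t)| + |z (l t) - z t| := abs_sub_le _ _ _
    _ < η / 2 + η / 2 := add_lt_add (h2t.trans_le (min_le_right _ _)) h3
    _ = η := add_halves η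

/-- Every time change fixes the endpoint `1`, so evaluation there is 1-Lipschitz. -/
theorem continuous_eval_one : Continuous fun x : SkorokhodSpace => x 1 := by
  refine LipschitzWith.continuous (K := 1) fun x y => ?_
  rw [ENNReal.coe_one, one_mul]
  refine le_iInf fun l => le_max_of_le_right ?_
  refine (le_of_eq ?_).trans (le_iSup (fun t => edist (x t) (y (l t))) 1)
  have : l 1 = 1 := l.map_top
  rw [this]

theorem isCadlag_of_continuous {f : unitInterval → ℝ} (hf : Continuous f) : IsCadlag f :=
  fun t => ⟨hf.continuousWithinAt, f t, (hf.tendsto t).mono_left nhdsWithin_le_nhds⟩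

theorem isCadlag_const (c : ℝ) : IsCadlag fun _ => c :=
  isCadlag_of_continuous continuous_const

open Classical in
/-- The element of `D[0,1]` with given values, or zero if these are not those of a càdlàg
function. -/
noncomputable def mkD (f : unitInterval → ℝ) : SkorokhodSpace :=
  if h : IsCadlag f then ⟨f, h⟩ else ⟨fun _ => 0, isCadlag_const 0⟩

theorem mkD_apply {f : unitInterval → ℝ} (h : IsCadlag f) (t : unitInterval) : mkD f t = f t := by
  simp [mkD, h]

theorem isCadlag_comp_floor (n : ℕ) (a : ℕ → ℝ) :
    IsCadlag fun t : unitInterval => a ⌊(n : ℝ) * t⌋₊ := by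
  have hmono : Monotone fun t : unitInterval => ⌊(n : ℝ) * t⌋₊ := fun s t hst =>
    Nat.floor_mono (mul_le_mul_of_nonneg_left hst n.cast_nonneg)
  intro t
  constructor
  · have h1 : ∀ᶠ s : unitInterval in 𝓝 t, (n : ℝ) * s < ⌊(n : ℝ) * t⌋₊ + 1 :=
      (by fun_prop : Continuous fun s : unitInterval => (n : ℝ) * s).continuousAt.eventually_lt
        continuousAt_const (Nat.lt_floor_add_one _)
    refine tendsto_const_nhds.congr' ?_
    filter_upwards [nhdsWithin_le_nhds h1, self_mem_nhdsWithin] with s hs hts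
    congr 1
    refine le_antisymm (hmono hts) (Nat.lt_succ_iff.1 ?_)
    rw [Nat.floor_lt (mul_nonneg n.cast_nonneg s.2.1)]
    exact_mod_cast hs
  · have h := hmono.tendsto_nhdsLT t
    exact ⟨_, (continuous_of_discreteTopology (f := a)).continuousAt.tendsto.comp h⟩

/-- The step function `t ↦ a ⌊n t⌋`. -/
noncomputable def stepD (n : ℕ) (a : ℕ → ℝ) : SkorokhodSpace :=
  ⟨fun t => a ⌊(n : ℝ) * t⌋₊, isCadlag_comp_floor n a⟩

theorem floor_mul_le (n : ℕ) (t : unitInterval) : ⌊(n : ℝ) * t⌋₊ ≤ n := by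
  refine Nat.floor_le_of_le ?_
  exact mul_le_of_le_one_right n.cast_nonneg t.2.2

/-- A step function depends on the finitely many values `a 0, …, a n`, and the resulting map from
`ℝ^(n+1)` to `D[0,1]` is 1-Lipschitz, hence Borel. No description of the Borel sets by evaluations
is needed. -/
theorem aemeasurable_stepD {Ω : Type*} [MeasurableSpace Ω] {P : Measure Ω} (n : ℕ)
    {a : Ω → ℕ → ℝ} (ha : ∀ j, AEMeasurable (fun ω => a ω j) P) :
    AEMeasurable (fun ω => stepD n (a ω)) P := by
  -- `Fin.ofNat` reduces modulo `n + 1`, which is harmless because only indices `⌊n t⌋ ≤ n` occur.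
  let g : (Fin (n + 1) → ℝ) → SkorokhodSpace := fun b => stepD n fun j => b (Fin.ofNat (n + 1) j)
  have hg : Continuous g := by
    refine LipschitzWith.continuous (K := 1) fun b c => ?_
    rw [ENNReal.coe_one, one_mul]
    exact edist_le_of_forall fun t => edist_le_pi_edist b c _
  have : (fun ω => stepD n (a ω)) = fun ω => g fun i => a ω i := by
    funext ω
    simp only [g, stepD, SkorokhodSpace.mk.injEq]
    funext t
    congr 1
    simp [Nat.mod_eq_of_lt (Nat.lt_succ_of_le (floor_mul_le n t))]
  rw [this]
  exact hg.measurable.comp_aemeasurable (aemeasurable_pi_lambda _ fun i => ha i)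

/-- The exponential of a càdlàg function. -/
noncomputable def expD (x : SkorokhodSpace) : SkorokhodSpace :=
  ⟨fun t => Real.exp (x t), fun t =>
    ⟨Real.continuous_exp.continuousAt.comp_continuousWithinAt (x.cadlag t).1,
      (x.cadlag t).2.imp' Real.exp fun _ h => (Real.continuous_exp.tendsto _).comp h⟩⟩

theorem tendsto_expD {z : SkorokhodSpace} (hz : Continuous z) :
    Tendsto expD (𝓝 z) (𝓝 (expD z)) := by
  obtain ⟨M, hM⟩ : ∃ M, ∀ t, z t ≤ M :=
    (isCompact_range hz).bddAbove.imp fun M hM t => hM (Set.mem_range_self t)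
  refine tendsto_of_forall_abs_sub_le fun η hη => ?_
  -- The bound `1` permits `|exp u - 1| ≤ 2|u|`; the other term cancels the factor `2 exp M`.
  have hpos : 0 < min 1 (η / (2 * Real.exp M)) := lt_min one_pos (by positivity)
  filter_upwards [eventually_forall_abs_sub_lt hz hpos] with x hx t
  have h1 := hx t
  have h2 := Real.abs_exp_sub_one_le (h1.le.trans (min_le_left _ _))
  have h3 : Real.exp (x t) - Real.exp (z t) = Real.exp (z t) * (Real.exp (x t - z t) - 1) := by
    rw [mul_sub, ← Real.exp_add]; ring_nf
  have h4 : |x t - z t| ≤ η / (2 * Real.exp M) := h1.le.trans (min_le_right _ _)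
  change |Real.exp (x t) - Real.exp (z t)| ≤ η
  rw [h3, abs_mul, Real.abs_exp]
  calc Real.exp (z t) * |Real.exp (x t - z t) - 1|
      ≤ Real.exp M * (2 * (η / (2 * Real.exp M))) := by
        gcongr
        · exact hM t
        · exact h2.trans (by gcongr)
    _ = η := by field_simp

end SkorokhodSpace

/-! ### Uniform convergence of Riemann sums. -/

/-- Right-endpoint Riemann sums of a continuous function on `[0,1]` converge to its primitive
uniformly. -/
theorem eventually_abs_riemannSum_sub_integral_le {f : ℝ → ℝ} (hf : Continuous f) {η : ℝ}
    (hη : 0 < η) : ∀ᶠ n : ℕ in atTop, ∀ t ∈ Set.Icc (0 : ℝ) 1,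
      |∑ k ∈ Finset.Icc 1 ⌊(n : ℝ) * t⌋₊, f ((k : ℝ) / n) / n - ∫ s in (0 : ℝ)..t, f s| ≤ η := by
  obtain ⟨M, hM⟩ := isCompact_Icc.exists_bound_of_continuousOn (s := Set.Icc (0 : ℝ) 1)
    hf.continuousOn
  have huc := isCompact_Icc.uniformContinuousOn_of_continuous (s := Set.Icc (0 : ℝ) 1)
    hf.continuousOn
  obtain ⟨δ, hδ, hδf⟩ := Metric.uniformContinuousOn_iff.1 huc (η / 2) (half_pos hη)
  have hM0 : 0 ≤ M := (norm_nonneg _).trans (hM 0 (by simp))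
  have e1 := (tendsto_one_div_atTop_nhds_zero_nat (𝕜 := ℝ)).eventually_lt_const hδ
  have e2 : ∀ᶠ n : ℕ in atTop, M * (1 / (n : ℝ)) < η / 2 := by
    have := (tendsto_one_div_atTop_nhds_zero_nat (𝕜 := ℝ)).const_mul M
    rw [mul_zero] at this
    exact this.eventually_lt_const (half_pos hη)
  filter_upwards [e1, e2, eventually_ge_atTop 1] with n hn1 hn2 hn t ht
  have hn0 : (0 : ℝ) < n := by exact_mod_cast hn
  have hii : ∀ a b, IntervalIntegrable f volume a b := fun a b => hf.intervalIntegrable a b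
  -- At grid points the error grows by at most `(η / 2) / n` per cell, by uniform continuity. The
  -- incomplete last cell is handled by the bound `M` on `|f|`.
  have step : ∀ j : ℕ, j ≤ n →
      |∑ k ∈ Finset.Icc 1 j, f ((k : ℝ) / n) / n - ∫ s in (0 : ℝ)..((j : ℝ) / n), f s|
        ≤ (η / 2) * ((j : ℝ) / n) := by
    intro j
    induction j with
    | zero => simp
    | succ j ih =>
      intro hj
      have ih' := ih (Nat.le_of_succ_le hj)
      rw [Finset.sum_Icc_succ_top (by omega),
        ← intervalIntegral.integral_add_adjacent_intervals (hii 0 ((j : ℝ) / n))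
          (hii ((j : ℝ) / n) (((j + 1 : ℕ) : ℝ) / n))]
      have hlen : ((j + 1 : ℕ) : ℝ) / n - (j : ℝ) / n = 1 / n := by push_cast; ring
      have hle : (j : ℝ) / n ≤ ((j + 1 : ℕ) : ℝ) / n := by
        rw [← sub_nonneg, hlen]; positivity
      have hle1 : ((j + 1 : ℕ) : ℝ) / n ≤ 1 := by
        rw [div_le_one hn0]; exact_mod_cast hj
      have hpiece : |f (((j + 1 : ℕ) : ℝ) / n) / n -
          ∫ s in ((j : ℝ) / n)..(((j + 1 : ℕ) : ℝ) / n), f s| ≤ (η / 2) * (1 / n) := by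
        have h1 : f (((j + 1 : ℕ) : ℝ) / n) / n - ∫ s in ((j : ℝ) / n)..(((j + 1 : ℕ) : ℝ) / n), f s
            = ∫ s in ((j : ℝ) / n)..(((j + 1 : ℕ) : ℝ) / n), (f (((j + 1 : ℕ) : ℝ) / n) - f s) := by
          rw [intervalIntegral.integral_sub (by simp) (hii _ _), intervalIntegral.integral_const,
            hlen, smul_eq_mul]
          ring
        rw [h1, ← Real.norm_eq_abs]
        refine (intervalIntegral.norm_integral_le_of_norm_le_const (C := η / 2) ?_).trans ?_
        · intro s hs
          rw [Set.uIoc_of_le hle] at hs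
          have hj0 : (0 : ℝ) ≤ (j : ℝ) / n := by positivity
          rw [← dist_eq_norm]
          refine (hδf _ ⟨hj0.trans hle, hle1⟩ s ⟨hj0.trans hs.1.le, hs.2.trans hle1⟩ ?_).le
          rw [Real.dist_eq, abs_of_nonneg (sub_nonneg.2 hs.2)]
          linarith [hs.1]
        · rw [hlen, abs_of_nonneg (by positivity)]
      calc _ = |(∑ k ∈ Finset.Icc 1 j, f ((k : ℝ) / n) / n - ∫ s in (0 : ℝ)..((j : ℝ) / n), f s)
            + (f (((j + 1 : ℕ) : ℝ) / n) / n -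
              ∫ s in ((j : ℝ) / n)..(((j + 1 : ℕ) : ℝ) / n), f s)| := by congr 1; ring
        _ ≤ (η / 2) * ((j : ℝ) / n) + (η / 2) * (1 / n) := (abs_add_le _ _).trans (by gcongr)
        _ = _ := by push_cast; ring
  set j := ⌊(n : ℝ) * t⌋₊ with hj
  have hnt : 0 ≤ (n : ℝ) * t := mul_nonneg hn0.le ht.1
  have hj1 : (j : ℝ) ≤ n * t := Nat.floor_le hnt
  have hj2 : (n : ℝ) * t < j + 1 := Nat.lt_floor_add_one _
  have hjn : j ≤ n := Nat.floor_le_of_le (mul_le_of_le_one_right hn0.le ht.2)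
  have hjt : (j : ℝ) / n ≤ t := by rw [div_le_iff₀ hn0]; linarith
  have htj : t - (j : ℝ) / n ≤ 1 / n := by
    rw [sub_le_iff_le_add, ← add_div, le_div_iff₀ hn0]; linarith
  have hrest : |∫ s in ((j : ℝ) / n)..t, f s| ≤ η / 2 := by
    rw [← Real.norm_eq_abs]
    refine (intervalIntegral.norm_integral_le_of_norm_le_const (C := M) ?_).trans ?_
    · intro s hs
      rw [Set.uIoc_of_le hjt] at hs
      exact hM s ⟨(by positivity : (0 : ℝ) ≤ (j : ℝ) / n).trans hs.1.le, hs.2.trans ht.2⟩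
    · rw [abs_of_nonneg (sub_nonneg.2 hjt)]
      exact (mul_le_mul_of_nonneg_left htj hM0).trans hn2.le
  rw [← intervalIntegral.integral_add_adjacent_intervals (hii 0 ((j : ℝ) / n)) (hii _ t),
    ← sub_sub]
  refine (abs_sub _ _).trans ((add_le_add (step j hjn) hrest).trans ?_)
  have : (j : ℝ) / n ≤ 1 := hjt.trans ht.2
  nlinarith

/-! ### Weighted Riemann sums with the weight truncated at level `ε`. -/

namespace SkorokhodSpace

/-- The point `k / n` of the unit interval. -/
noncomputable def gridPoint (n k : ℕ) : unitInterval := Set.projIcc 0 1 zero_le_one ((k : ℝ) / n)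

/-- The Riemann sum of `x(s) / max s ε` with mesh `1 / n` over the first `j` grid points. -/
noncomputable def wsum (n : ℕ) (ε : ℝ) (x : unitInterval → ℝ) (j : ℕ) : ℝ :=
  ∑ k ∈ Finset.Icc 1 j, x (gridPoint n k) / (n * max ((k : ℝ) / n) ε)

/-- The Riemann sums of `x(s) / max s ε` as a step function of the upper limit. -/
noncomputable def riem (n : ℕ) (ε : ℝ) (x : SkorokhodSpace) : SkorokhodSpace :=
  stepD n (wsum n ε x)

/-- The primitive of `z(s) / max s ε` (which is `z(s) / s` for `ε = 0`). -/
noncomputable def primD (ε : ℝ) (z : SkorokhodSpace) : SkorokhodSpace :=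
  mkD fun t => ∫ s in (0 : ℝ)..t, Set.IccExtend zero_le_one z s / max s ε

theorem continuous_extend_div_max {z : SkorokhodSpace} (hz : Continuous z) {ε : ℝ} (hε : 0 < ε) :
    Continuous fun s : ℝ => Set.IccExtend zero_le_one z s / max s ε :=
  (hz.Icc_extend' (h := zero_le_one)).div (by fun_prop)
    fun s => (lt_max_of_lt_right hε).ne'

theorem continuous_primitive_extend {z : SkorokhodSpace} (hz : Continuous z) {ε : ℝ} (hε : 0 < ε) :
    Continuous fun t : unitInterval =>
      ∫ s in (0 : ℝ)..t, Set.IccExtend zero_le_one z s / max s ε :=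
  (intervalIntegral.continuous_primitive
    (fun a b => (continuous_extend_div_max hz hε).intervalIntegrable a b) 0).comp
    continuous_subtype_val

theorem primD_apply {z : SkorokhodSpace} (hz : Continuous z) {ε : ℝ} (hε : 0 < ε)
    (t : unitInterval) :
    primD ε z t = ∫ s in (0 : ℝ)..t, Set.IccExtend zero_le_one z s / max s ε :=
  mkD_apply (isCadlag_of_continuous (continuous_primitive_extend hz hε)) t

theorem continuous_primD {z : SkorokhodSpace} (hz : Continuous z) {ε : ℝ} (hε : 0 < ε) :
    Continuous (primD ε z) := by
  convert continuous_primitive_extend hz hε using 1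
  exact funext fun t => primD_apply hz hε t

/-- Near a continuous `z` the paths are uniformly close, and the truncated weight is at most `1 /
ε`; so the sums for `x` and `z` are close uniformly in `n`, and those for `z` are ordinary Riemann
sums. Convergence is joint in `(n, x)`, as `extended_continuous_mapping` requires. -/
theorem tendsto_riem {z : SkorokhodSpace} (hz : Continuous z) {ε : ℝ} (hε : 0 < ε) :
    Tendsto (fun p : ℕ × SkorokhodSpace => riem p.1 ε p.2) (atTop ×ˢ 𝓝 z) (𝓝 (primD ε z)) := by
  refine tendsto_of_forall_abs_sub_le fun η hη => ?_
  have h1 := (eventually_abs_riemannSum_sub_integral_le (continuous_extend_div_max hz hε)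
    (half_pos hη)).and (eventually_ge_atTop 1)
  have h2 := eventually_forall_abs_sub_lt hz (η := η / 2 * ε) (by positivity)
  filter_upwards [h1.prod_mk h2] with p hp t
  obtain ⟨n, x⟩ := p
  obtain ⟨⟨hn, hn1⟩, hx⟩ := hp
  have hn0 : (0 : ℝ) < n := by exact_mod_cast hn1
  rw [primD_apply hz hε]
  have hnt := hn t t.2
  have hz' : wsum n ε z ⌊(n : ℝ) * t⌋₊ = ∑ k ∈ Finset.Icc 1 ⌊(n : ℝ) * t⌋₊,
      Set.IccExtend zero_le_one z ((k : ℝ) / n) / max ((k : ℝ) / n) ε / n := by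
    refine Finset.sum_congr rfl fun k _ => ?_
    rw [div_div, mul_comm (n : ℝ)]
    rfl
  rw [← hz'] at hnt
  have hxz : |wsum n ε x ⌊(n : ℝ) * t⌋₊ - wsum n ε z ⌊(n : ℝ) * t⌋₊| ≤ η / 2 := by
    rw [wsum, wsum, ← Finset.sum_sub_distrib]
    refine (Finset.abs_sum_le_sum_abs _ _).trans ?_
    have : ∀ k ∈ Finset.Icc 1 ⌊(n : ℝ) * t⌋₊, |x (gridPoint n k) / (n * max ((k : ℝ) / n) ε) -
        z (gridPoint n k) / (n * max ((k : ℝ) / n) ε)| ≤ η / 2 / n := by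
      intro k _
      have hpos : 0 < max ((k : ℝ) / n) ε := lt_max_of_lt_right hε
      rw [← sub_div, abs_div, abs_of_pos (mul_pos hn0 hpos), div_le_div_iff₀ (by positivity) hn0]
      calc |x (gridPoint n k) - z (gridPoint n k)| * n ≤ (η / 2 * ε) * n := by
            gcongr; exact (hx _).le
        _ ≤ (η / 2 * max ((k : ℝ) / n) ε) * n := by gcongr; exact le_max_right _ _
        _ = _ := by ring
    refine (Finset.sum_le_card_nsmul _ _ _ this).trans ?_
    rw [Nat.card_Icc, nsmul_eq_mul, Nat.add_sub_cancel, ← mul_div_assoc, div_le_iff₀ hn0,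
      mul_comm]
    gcongr
    exact floor_mul_le n t
  calc |riem n ε x t - _| ≤ _ := abs_sub_le _ (wsum n ε z ⌊(n : ℝ) * t⌋₊) _
    _ ≤ η / 2 + η / 2 := add_le_add hxz hnt
    _ = η := add_halves η

theorem aemeasurable_wsum {Ω : Type*} [MeasurableSpace Ω] {P : Measure Ω} {X : Ω → SkorokhodSpace}
    {n : ℕ} (hX : ∀ k, AEMeasurable (fun ω => X ω (gridPoint n k)) P) (ε : ℝ) (j : ℕ) :
    AEMeasurable (fun ω => wsum n ε (X ω) j) P :=
  Finset.aemeasurable_fun_sum _ fun k _ => (hX k).div_const _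

theorem aemeasurable_riem {Ω : Type*} [MeasurableSpace Ω] {P : Measure Ω} {X : Ω → SkorokhodSpace}
    {n : ℕ} (hX : ∀ k, AEMeasurable (fun ω => X ω (gridPoint n k)) P) (ε : ℝ) :
    AEMeasurable (fun ω => riem n ε (X ω)) P :=
  aemeasurable_stepD n fun j => aemeasurable_wsum hX ε j

/-! The limit `ε → 0`. -/

theorem continuous_primitive_extend_zero {z : SkorokhodSpace}
    (hint : IntervalIntegrable (fun s : ℝ => Set.IccExtend zero_le_one z s / s) volume 0 1) :
    Continuous fun t : unitInterval =>
      ∫ s in (0 : ℝ)..t, Set.IccExtend zero_le_one z s / max s 0 := by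
  have h := intervalIntegral.continuousOn_primitive_interval (μ := volume) (a := 0) (b := 1)
    (f := fun s : ℝ => Set.IccExtend zero_le_one z s / s) (by
      rw [Set.uIcc_of_le zero_le_one, integrableOn_Icc_iff_integrableOn_Ioc]
      rwa [intervalIntegrable_iff_integrableOn_Ioc_of_le zero_le_one] at hint)
  rw [Set.uIcc_of_le zero_le_one] at h
  have h' := h.domRestrict
  convert h' using 1
  funext t
  refine intervalIntegral.integral_congr fun s hs => ?_
  rw [Set.uIcc_of_le t.2.1] at hs
  simp only [max_eq_left hs.1]

theorem primD_zero_apply {z : SkorokhodSpace}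
    (hint : IntervalIntegrable (fun s : ℝ => Set.IccExtend zero_le_one z s / s) volume 0 1)
    (t : unitInterval) :
    primD 0 z t = ∫ s in (0 : ℝ)..t, Set.IccExtend zero_le_one z s / s := by
  rw [primD, mkD_apply (isCadlag_of_continuous (continuous_primitive_extend_zero hint))]
  refine intervalIntegral.integral_congr fun s hs => ?_
  rw [Set.uIcc_of_le t.2.1] at hs
  simp only [max_eq_left hs.1]

theorem continuous_primD_zero {z : SkorokhodSpace}
    (hint : IntervalIntegrable (fun s : ℝ => Set.IccExtend zero_le_one z s / s) volume 0 1) :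
    Continuous (primD 0 z) := by
  convert continuous_primitive_extend_zero hint using 1
  exact funext fun t => mkD_apply (isCadlag_of_continuous (continuous_primitive_extend_zero hint)) t

/-- The difference of the primitives is bounded, for all `t` at once, by the `L¹` distance of the
integrands on `[0,1]`. This tends to zero by dominated convergence: the distance is dominated by
`|z(s)/s|`, and at each `s > 0` it vanishes once `ε m < s`. -/
theorem tendsto_primD {z : SkorokhodSpace} (hz : Continuous z)
    (hint : IntervalIntegrable (fun s : ℝ => Set.IccExtend zero_le_one z s / s) volume 0 1)
    {ε : ℕ → ℝ} (hε : ∀ m, 0 < ε m) (hε0 : Tendsto ε atTop (𝓝 0)) :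
    Tendsto (fun m => primD (ε m) z) atTop (𝓝 (primD 0 z)) := by
  set f := Set.IccExtend zero_le_one z with hf
  have hii : ∀ m, IntervalIntegrable (fun s => f s / max s (ε m)) volume 0 1 := fun m =>
    (continuous_extend_div_max hz (hε m)).intervalIntegrable 0 1
  have hlim : Tendsto (fun m => ∫ s in (0 : ℝ)..1, |f s / max s (ε m) - f s / s|) atTop (𝓝 0) := by
    have := intervalIntegral.tendsto_integral_filter_of_dominated_convergence
      (F := fun m s => |f s / max s (ε m) - f s / s|) (f := fun _ => (0 : ℝ)) (a := 0) (b := 1)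
      (μ := volume) (l := atTop) (fun s => |f s / s|) ?_ ?_ hint.abs ?_
    · simpa using this
    · exact Eventually.of_forall fun m =>
        ((hii m).sub hint).abs.aestronglyMeasurable_restrict_uIoc
    · refine Eventually.of_forall fun m => Eventually.of_forall fun s hs => ?_
      rw [Set.uIoc_of_le zero_le_one] at hs
      rw [Real.norm_eq_abs, abs_abs, div_eq_mul_inv, div_eq_mul_inv, ← mul_sub, abs_mul, abs_mul]
      refine mul_le_mul_of_nonneg_left ?_ (abs_nonneg _)
      have h1 : (max s (ε m))⁻¹ ≤ s⁻¹ := inv_anti₀ hs.1 (le_max_left _ _)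
      have h2 : 0 ≤ (max s (ε m))⁻¹ := inv_nonneg.2 (hs.1.le.trans (le_max_left _ _))
      rw [abs_of_nonpos (by linarith), abs_of_pos (inv_pos.2 hs.1)]
      linarith
    · refine Eventually.of_forall fun s hs => ?_
      rw [Set.uIoc_of_le zero_le_one] at hs
      refine tendsto_const_nhds.congr' ?_
      filter_upwards [hε0.eventually_lt_const hs.1] with m hm
      rw [max_eq_left hm.le, sub_self, abs_zero]
  refine tendsto_of_forall_abs_sub_le fun η hη => ?_
  filter_upwards [hlim.eventually_lt_const hη] with m hm t
  rw [primD_apply hz (hε m), primD_zero_apply hint]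
  have hsub : Set.uIcc (0 : ℝ) t ⊆ Set.uIcc 0 1 := by
    rw [Set.uIcc_of_le t.2.1, Set.uIcc_of_le zero_le_one]
    exact Set.Icc_subset_Icc_right t.2.2
  rw [← intervalIntegral.integral_sub ((hii m).mono_set hsub) (hint.mono_set hsub)]
  refine (intervalIntegral.abs_integral_le_integral_abs t.2.1).trans (le_trans ?_ hm.le)
  exact intervalIntegral.integral_mono_interval le_rfl t.2.1 t.2.2
    (Eventually.of_forall fun _ => abs_nonneg _) ((hii m).sub hint).abs

end SkorokhodSpace

/-! ### First-moment bounds and removal of the truncation. -/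

theorem sum_one_div_sqrt_le (m : ℕ) : ∑ k ∈ Finset.Icc 1 m, 1 / √(k : ℝ) ≤ 2 * √(m : ℝ) := by
  induction m with
  | zero => simp
  | succ m ih =>
    rw [Finset.sum_Icc_succ_top (by omega)]
    have h1 : 0 < √((m + 1 : ℕ) : ℝ) := Real.sqrt_pos.2 (by positivity)
    have h2 := Real.sq_sqrt (show (0 : ℝ) ≤ ((m + 1 : ℕ) : ℝ) by positivity)
    have h3 := Real.sq_sqrt (show (0 : ℝ) ≤ (m : ℝ) by positivity)
    have h4 := Real.sqrt_nonneg (m : ℝ)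
    -- The telescoping comparison; after clearing denominators it is `(√(m+1) - √m)² ≥ 0`.
    have h5 : 1 / √((m + 1 : ℕ) : ℝ) ≤ 2 * √((m + 1 : ℕ) : ℝ) - 2 * √(m : ℝ) := by
      rw [div_le_iff₀ h1]
      push_cast at *
      nlinarith [sq_nonneg (√((m : ℝ) + 1) - √(m : ℝ))]
    linarith

/-- First moments of order `√(k/n)` make the weighted sums `∑ |Y k| / k` small in mean. -/
theorem lintegral_sum_abs_div_le {Ω : Type*} [MeasurableSpace Ω] {P : Measure Ω} {Y : ℕ → Ω → ℝ}
    {C : ℝ} (hC : 0 ≤ C) {m n : ℕ} (hY : ∀ k, AEMeasurable (Y k) P)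
    (hmom : ∀ k ∈ Finset.Icc 1 m, ∫⁻ ω, ‖Y k ω‖ₑ ∂P ≤ ENNReal.ofReal (C * √((k : ℝ) / n))) :
    ∫⁻ ω, ENNReal.ofReal (∑ k ∈ Finset.Icc 1 m, |Y k ω| / k) ∂P ≤
      ENNReal.ofReal (2 * C * √((m : ℝ) / n)) := by
  have h1 : ∀ k ω, ENNReal.ofReal (|Y k ω| / k) = ‖Y k ω‖ₑ * ENNReal.ofReal (1 / (k : ℝ)) := by
    intro k ω
    rw [div_eq_mul_one_div, ENNReal.ofReal_mul (abs_nonneg _), Real.enorm_eq_ofReal_abs]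
  calc ∫⁻ ω, ENNReal.ofReal (∑ k ∈ Finset.Icc 1 m, |Y k ω| / k) ∂P
      = ∑ k ∈ Finset.Icc 1 m, (∫⁻ ω, ‖Y k ω‖ₑ ∂P) * ENNReal.ofReal (1 / (k : ℝ)) := by
        rw [← Finset.sum_congr rfl fun k _ => lintegral_mul_const'' _ (hY k).enorm,
          ← lintegral_finsetSum' _ fun k _ => (hY k).enorm.mul_const _]
        refine lintegral_congr fun ω => ?_
        rw [ENNReal.ofReal_sum_of_nonneg fun k _ => by positivity]
        exact Finset.sum_congr rfl fun k _ => h1 k ω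
    _ ≤ ∑ k ∈ Finset.Icc 1 m, ENNReal.ofReal (C * √((k : ℝ) / n)) * ENNReal.ofReal (1 / (k : ℝ)) :=
        Finset.sum_le_sum fun k hk => by gcongr; exact hmom k hk
    _ = ENNReal.ofReal (∑ k ∈ Finset.Icc 1 m, C * √((k : ℝ) / n) * (1 / (k : ℝ))) := by
        rw [ENNReal.ofReal_sum_of_nonneg fun k _ => by positivity]
        exact Finset.sum_congr rfl fun k _ => (ENNReal.ofReal_mul (by positivity)).symm
    _ ≤ ENNReal.ofReal (2 * C * √((m : ℝ) / n)) := by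
        refine ENNReal.ofReal_le_ofReal ?_
        have h2 : ∀ k ∈ Finset.Icc 1 m, C * √((k : ℝ) / n) * (1 / (k : ℝ)) =
            C / √(n : ℝ) * (1 / √(k : ℝ)) := by
          intro k hk
          have hk0 : (0 : ℝ) < k := by exact_mod_cast (Finset.mem_Icc.1 hk).1
          rw [Real.sqrt_div hk0.le]
          have h3 : √(k : ℝ) * (1 / k) = 1 / √(k : ℝ) := by
            rw [mul_one_div, Real.sqrt_div_self']
          calc C * (√(k : ℝ) / √(n : ℝ)) * (1 / k) = C / √(n : ℝ) * (√(k : ℝ) * (1 / k)) := by ring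
            _ = _ := by rw [h3]
        rw [Finset.sum_congr rfl h2, ← Finset.mul_sum, Real.sqrt_div m.cast_nonneg]
        calc C / √(n : ℝ) * ∑ k ∈ Finset.Icc 1 m, 1 / √(k : ℝ)
            ≤ C / √(n : ℝ) * (2 * √(m : ℝ)) := by gcongr; exact sum_one_div_sqrt_le m
          _ = _ := by ring

namespace SkorokhodSpace

theorem coe_gridPoint {n k : ℕ} (hk : k ≤ n) : (gridPoint n k : ℝ) = (k : ℝ) / n := by
  have h : (k : ℝ) / n ∈ Set.Icc (0 : ℝ) 1 :=
    ⟨by positivity, div_le_one_of_le₀ (by exact_mod_cast hk) n.cast_nonneg⟩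
  rw [gridPoint, Set.projIcc_of_mem zero_le_one h]

theorem mul_max_zero {n : ℕ} (hn : 1 ≤ n) (k : ℕ) : (n : ℝ) * max ((k : ℝ) / n) 0 = k := by
  have hn0 : (0 : ℝ) < n := by exact_mod_cast hn
  rw [max_eq_left (by positivity)]
  field_simp

theorem wsum_zero {n : ℕ} (hn : 1 ≤ n) (x : unitInterval → ℝ) (j : ℕ) :
    wsum n 0 x j = ∑ k ∈ Finset.Icc 1 j, x (gridPoint n k) / k := by
  simp_rw [wsum, mul_max_zero hn]

/-- The two weights agree once `k / n ≥ ε`; for smaller `k` they are nonnegative and at most `1 /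
k`, so their difference is too. -/
theorem edist_riem_zero_le {n : ℕ} (hn : 1 ≤ n) {ε : ℝ} (hε : 0 ≤ ε) (x : SkorokhodSpace) :
    edist (riem n 0 x) (riem n ε x) ≤
      ENNReal.ofReal (∑ k ∈ Finset.Icc 1 ⌊ε * n⌋₊, |x (gridPoint n k)| / k) := by
  have hn0 : (0 : ℝ) < n := by exact_mod_cast hn
  refine edist_le_ofReal fun t => ?_
  change |wsum n 0 x _ - wsum n ε x _| ≤ _
  rw [wsum, wsum, ← Finset.sum_sub_distrib]
  refine (Finset.abs_sum_le_sum_abs _ _).trans ?_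
  have hterm : ∀ k ∈ Finset.Icc 1 ⌊(n : ℝ) * t⌋₊,
      |x (gridPoint n k) / (n * max ((k : ℝ) / n) 0) -
          x (gridPoint n k) / (n * max ((k : ℝ) / n) ε)|
        ≤ if k ≤ ⌊ε * n⌋₊ then |x (gridPoint n k)| / k else 0 := by
    intro k hk
    have hk0 : (0 : ℝ) < k := by exact_mod_cast (Finset.mem_Icc.1 hk).1
    split_ifs with hke
    · have h1 : (k : ℝ) ≤ n * max ((k : ℝ) / n) ε := by
        refine (mul_max_zero hn k).symm.le.trans ?_
        gcongr
      have h2 := inv_anti₀ hk0 h1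
      have h3 : 0 ≤ ((n : ℝ) * max ((k : ℝ) / n) ε)⁻¹ := inv_nonneg.2 (hk0.le.trans h1)
      rw [mul_max_zero hn, div_eq_mul_inv _ (k : ℝ), div_eq_mul_inv _ ((n : ℝ) * _),
        div_eq_mul_inv _ (k : ℝ), ← mul_sub, abs_mul]
      refine mul_le_mul_of_nonneg_left ?_ (abs_nonneg _)
      rw [abs_of_nonneg (sub_nonneg.2 h2)]
      exact sub_le_self _ h3
    · have h1 : ε * n < k := (Nat.floor_lt (by positivity)).1 (not_le.1 hke)
      have h2 : ε ≤ (k : ℝ) / n := by rw [le_div_iff₀ hn0]; exact h1.le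
      rw [max_eq_left h2, max_eq_left (by positivity), sub_self, abs_zero]
  refine (Finset.sum_le_sum hterm).trans ?_
  rw [← Finset.sum_filter]
  refine Finset.sum_le_sum_of_subset_of_nonneg ?_ fun k _ _ => by positivity
  intro k hk
  simp only [Finset.mem_filter, Finset.mem_Icc] at hk ⊢
  exact ⟨hk.1.1, hk.2⟩

variable {Ω Ω' : Type*} [MeasurableSpace Ω] [MeasurableSpace Ω']
  {P : Measure Ω} {Q : Measure Ω'}

theorem tendsto_riem_self {z : SkorokhodSpace} (hz : Continuous z) {ε : ℝ} (hε : 0 < ε) :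
    Tendsto (fun n : ℕ => riem n ε z) atTop (𝓝 (primD ε z)) := by
  have h1 : Tendsto (fun n : ℕ => (n, z)) atTop (atTop ×ˢ 𝓝 z) :=
    Tendsto.prodMk tendsto_id tendsto_const_nhds
  have h2 := (tendsto_riem hz hε).comp h1
  exact h2

theorem aemeasurable_primD {Z : Ω' → SkorokhodSpace} (hcont : ∀ᵐ ω ∂Q, Continuous (Z ω))
    (hZ : ∀ t, AEMeasurable (fun ω => Z ω t) Q) {ε : ℝ} (hε : 0 < ε) :
    AEMeasurable (fun ω => primD ε (Z ω)) Q := by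
  refine aemeasurable_of_tendsto_metrizable_ae atTop
    (f := fun n ω => riem n ε (Z ω)) (fun n => aemeasurable_riem (fun k => hZ _) ε) ?_
  filter_upwards [hcont] with ω hω
  exact tendsto_riem_self hω hε

/-- The exponential of a step function is again a step function, so the paths are almost everywhere
limits of measurable ones and no measurability of `expD` itself is needed. -/
theorem aemeasurable_expD_primD {Z : Ω' → SkorokhodSpace} (hcont : ∀ᵐ ω ∂Q, Continuous (Z ω))
    (hZ : ∀ t, AEMeasurable (fun ω => Z ω t) Q) {ε : ℝ} (hε : 0 < ε) :
    AEMeasurable (fun ω => expD (primD ε (Z ω))) Q := by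
  refine aemeasurable_of_tendsto_metrizable_ae atTop
    (f := fun n ω => expD (riem n ε (Z ω))) (fun n => ?_) ?_
  · exact aemeasurable_stepD n fun j =>
      Real.measurable_exp.comp_aemeasurable (aemeasurable_wsum (fun k => hZ _) ε j)
  · filter_upwards [hcont] with ω hω
    exact (tendsto_expD (continuous_primD hω hε)).comp
      (tendsto_riem_self hω hε)

theorem aemeasurable_primD_zero {Z : Ω' → SkorokhodSpace} (hcont : ∀ᵐ ω ∂Q, Continuous (Z ω))
    (hZ : ∀ t, AEMeasurable (fun ω => Z ω t) Q)
    (hint : ∀ᵐ ω ∂Q, IntervalIntegrable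
      (fun s : ℝ => Set.IccExtend zero_le_one (Z ω) s / s) volume 0 1) :
    AEMeasurable (fun ω => primD 0 (Z ω)) Q := by
  refine aemeasurable_of_tendsto_metrizable_ae atTop
    (fun m : ℕ => aemeasurable_primD hcont hZ (Nat.one_div_pos_of_nat (n := m) (α := ℝ))) ?_
  filter_upwards [hcont, hint] with ω hω hi
  exact tendsto_primD hω hi (fun m => Nat.one_div_pos_of_nat) tendsto_one_div_add_atTop_nhds_zero_nat

theorem aemeasurable_expD_primD_zero {Z : Ω' → SkorokhodSpace}
    (hcont : ∀ᵐ ω ∂Q, Continuous (Z ω)) (hZ : ∀ t, AEMeasurable (fun ω => Z ω t) Q)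
    (hint : ∀ᵐ ω ∂Q, IntervalIntegrable
      (fun s : ℝ => Set.IccExtend zero_le_one (Z ω) s / s) volume 0 1) :
    AEMeasurable (fun ω => expD (primD 0 (Z ω))) Q := by
  refine aemeasurable_of_tendsto_metrizable_ae atTop
    (fun m : ℕ => aemeasurable_expD_primD hcont hZ (Nat.one_div_pos_of_nat (n := m) (α := ℝ))) ?_
  filter_upwards [hcont, hint] with ω hω hi
  exact (tendsto_expD (continuous_primD_zero hi)).comp
    (tendsto_primD hω hi (fun m => Nat.one_div_pos_of_nat) tendsto_one_div_add_atTop_nhds_zero_nat)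

/-- Riemann sums of `|Z(s)| / max s (ε m)` have mean at most `2C`, uniformly in `n` and `m`. Fatou's
lemma carries this bound to the truncated integrals, then to their liminf in `m`, which is therefore
finite almost surely; a last Fatou in `s` removes the truncation pathwise. Working through Riemann
sums avoids joint measurability in `(ω, s)`. -/
theorem ae_intervalIntegrable_div {Z : Ω' → SkorokhodSpace} (hcont : ∀ᵐ ω ∂Q, Continuous (Z ω))
    (hZ : ∀ t, AEMeasurable (fun ω => Z ω t) Q) {C : ℝ} (hC : 0 ≤ C)
    (hmom : ∀ t, ∫⁻ ω, ‖Z ω t‖ₑ ∂Q ≤ ENNReal.ofReal (C * √(t : ℝ))) :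
    ∀ᵐ ω ∂Q, IntervalIntegrable
      (fun s : ℝ => Set.IccExtend zero_le_one (Z ω) s / s) volume 0 1 := by
  let ε : ℕ → ℝ := fun m => 1 / ((m : ℝ) + 1)
  have hε : ∀ m, 0 < ε m := fun m => Nat.one_div_pos_of_nat
  have hε0 : Tendsto ε atTop (𝓝 0) := tendsto_one_div_add_atTop_nhds_zero_nat
  let f : ℕ → Ω' → ℝ → ℝ := fun m ω s => |Set.IccExtend zero_le_one (Z ω) s / max s (ε m)|
  let R : ℕ → ℕ → Ω' → ℝ := fun m n ω => ∑ k ∈ Finset.Icc 1 n, f m ω ((k : ℝ) / n) / n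
  let J : ℕ → Ω' → ℝ≥0∞ := fun m ω => ENNReal.ofReal (∫ s in (0 : ℝ)..1, f m ω s)
  have hfc : ∀ m ω, Continuous (Z ω) → Continuous (f m ω) := fun m ω h =>
    (continuous_extend_div_max h (hε m)).abs
  have hR : ∀ m, ∀ᵐ ω ∂Q, Tendsto (fun n => ENNReal.ofReal (R m n ω)) atTop (𝓝 (J m ω)) := by
    intro m
    filter_upwards [hcont] with ω hω
    refine (ENNReal.continuous_ofReal.tendsto _).comp ?_
    rw [Metric.tendsto_nhds]
    intro η hη
    filter_upwards [eventually_abs_riemannSum_sub_integral_le (hfc m ω hω) (half_pos hη)] with n hn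
    have := hn 1 (by simp)
    rw [mul_one, Nat.floor_natCast] at this
    rw [Real.dist_eq]
    exact this.trans_lt (half_lt_self hη)
  have hRm : ∀ m n, AEMeasurable (fun ω => ENNReal.ofReal (R m n ω)) Q := fun m n =>
    (Finset.aemeasurable_fun_sum _ fun k _ =>
      (((hZ _).div_const _).abs.div_const _)).ennreal_ofReal
  have hJm : ∀ m, AEMeasurable (J m) Q := fun m =>
    aemeasurable_of_tendsto_metrizable_ae atTop (hRm m) (hR m)
  have hRle : ∀ m n, 1 ≤ n → ∫⁻ ω, ENNReal.ofReal (R m n ω) ∂Q ≤ ENNReal.ofReal (2 * C) := by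
    intro m n hn
    have hn0 : (0 : ℝ) < n := by exact_mod_cast hn
    have h := lintegral_sum_abs_div_le (P := Q) (Y := fun k ω => Z ω (gridPoint n k)) hC
      (m := n) (n := n) (fun k => hZ _) (fun k hk => by
        rw [← coe_gridPoint (Finset.mem_Icc.1 hk).2]
        exact hmom _)
    rw [div_self hn0.ne', Real.sqrt_one, mul_one] at h
    refine (lintegral_mono fun ω => ENNReal.ofReal_le_ofReal ?_).trans h
    refine Finset.sum_le_sum fun k hk => ?_
    have hk0 : (0 : ℝ) < k := by exact_mod_cast (Finset.mem_Icc.1 hk).1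
    have hpos : 0 < max ((k : ℝ) / n) (ε m) := lt_max_of_lt_right (hε m)
    change |Z ω (gridPoint n k) / max ((k : ℝ) / n) (ε m)| / n ≤ _
    rw [abs_div, abs_of_pos hpos, div_div]
    refine div_le_div_of_nonneg_left (abs_nonneg _) hk0 ?_
    calc (k : ℝ) = k / n * n := by field_simp
      _ ≤ _ := by gcongr; exact le_max_left _ _
  have hJle : ∀ m, ∫⁻ ω, J m ω ∂Q ≤ ENNReal.ofReal (2 * C) := by
    intro m
    calc ∫⁻ ω, J m ω ∂Q = ∫⁻ ω, liminf (fun n => ENNReal.ofReal (R m n ω)) atTop ∂Q :=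
          lintegral_congr_ae ((hR m).mono fun ω h => h.liminf_eq.symm)
      _ ≤ liminf (fun n => ∫⁻ ω, ENNReal.ofReal (R m n ω) ∂Q) atTop := lintegral_liminf_le' (hRm m)
      _ ≤ _ := liminf_le_of_frequently_le'
          ((eventually_ge_atTop 1).mono fun n hn => hRle m n hn).frequently
  have hfin : ∀ᵐ ω ∂Q, liminf (fun m => J m ω) atTop < ∞ := by
    have hm : AEMeasurable (fun ω => liminf (fun m => J m ω) atTop) Q := by
      refine ⟨fun ω => liminf (fun m => (hJm m).mk _ ω) atTop,
        Measurable.liminf fun m => (hJm m).measurable_mk, ?_⟩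
      filter_upwards [ae_all_iff.2 fun m => (hJm m).ae_eq_mk] with ω hω
      simp only [hω]
    refine ae_lt_top' hm (ne_top_of_le_ne_top (ENNReal.ofReal_ne_top (r := 2 * C)) ?_)
    exact (lintegral_liminf_le' hJm).trans (liminf_le_of_frequently_le'
      (Eventually.of_forall hJle).frequently)
  filter_upwards [hcont, hfin] with ω hω hlt
  rw [intervalIntegrable_iff_integrableOn_Ioc_of_le zero_le_one]
  have hmeas : ∀ m, AEMeasurable (fun s => ENNReal.ofReal (f m ω s))
      (volume.restrict (Set.Ioc 0 1)) := fun m => (hfc m ω hω).measurable.ennreal_ofReal.aemeasurable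
  refine ⟨((hω.Icc_extend' (h := zero_le_one)).measurable.div
    measurable_id).aestronglyMeasurable, ?_⟩
  rw [hasFiniteIntegral_iff_enorm]
  calc ∫⁻ s in Set.Ioc (0 : ℝ) 1, ‖Set.IccExtend zero_le_one (Z ω) s / s‖ₑ
      = ∫⁻ s in Set.Ioc (0 : ℝ) 1, liminf (fun m => ENNReal.ofReal (f m ω s)) atTop := by
        refine setLIntegral_congr_fun measurableSet_Ioc fun s hs => ?_
        refine (Tendsto.liminf_eq ?_).symm
        refine tendsto_const_nhds.congr' ?_
        filter_upwards [hε0.eventually_lt_const hs.1] with m hm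
        simp only [f]
        rw [max_eq_left hm.le, Real.enorm_eq_ofReal_abs]
    _ ≤ liminf (fun m => ∫⁻ s in Set.Ioc (0 : ℝ) 1, ENNReal.ofReal (f m ω s)) atTop :=
        lintegral_liminf_le' hmeas
    _ = liminf (fun m => J m ω) atTop := by
        congr 1
        funext m
        simp only [J]
        rw [intervalIntegral.integral_of_le zero_le_one, ofReal_integral_eq_lintegral_ofReal]
        · exact ((hfc m ω hω).integrableOn_Icc (a := 0) (b := 1)).mono_set Set.Ioc_subset_Icc_self
        · exact Eventually.of_forall fun s => abs_nonneg _
    _ < ∞ := hlt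

/-- **Convergence of weighted Riemann sums.** If `X n` converges in distribution in `D[0,1]` to a
continuous process `Z` and `E |X n (k/n)| ≤ C √(k/n)`, then the processes
`t ↦ ∑_{k ≤ n t} X n (k/n) / k` converge in distribution in `D[0,1]` to `t ↦ ∫_0^t Z(s)/s ds`. -/
theorem tendstoInDistribution_riem_zero [IsProbabilityMeasure P] [IsProbabilityMeasure Q]
    {X : ℕ → Ω → SkorokhodSpace} {Z : Ω' → SkorokhodSpace}
    (hXZ : TendstoInDistribution X atTop Z (fun _ => P) Q)
    (hcont : ∀ᵐ ω ∂Q, Continuous (Z ω)) (hZ : ∀ t, AEMeasurable (fun ω => Z ω t) Q)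
    (hint : ∀ᵐ ω ∂Q, IntervalIntegrable
      (fun s : ℝ => Set.IccExtend zero_le_one (Z ω) s / s) volume 0 1)
    (hX : ∀ n k, AEMeasurable (fun ω => X n ω (gridPoint n k)) P) {C : ℝ} (hC : 0 ≤ C)
    (hmom : ∀ n k, 1 ≤ k → k ≤ n →
      ∫⁻ ω, ‖X n ω (gridPoint n k)‖ₑ ∂P ≤ ENNReal.ofReal (C * √((k : ℝ) / n))) :
    TendstoInDistribution (fun n ω => riem n 0 (X n ω)) atTop (fun ω => primD 0 (Z ω))
      (fun _ => P) Q := by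
  let ε : ℕ → ℝ := fun m => 1 / ((m : ℝ) + 1)
  have hε : ∀ m, 0 < ε m := fun m => Nat.one_div_pos_of_nat
  have hε0 : Tendsto ε atTop (𝓝 0) := tendsto_one_div_add_atTop_nhds_zero_nat
  refine tendstoInDistribution_of_converging_together
    (A := fun m n ω => riem n (ε m) (X n ω)) (B := fun m ω => primD (ε m) (Z ω)) (fun m => ?_)
    (fun n => aemeasurable_riem (hX n) 0) (aemeasurable_primD_zero hcont hZ hint) ?_ ?_
  · exact hXZ.extended_continuous_mapping (h := fun n x => riem n (ε m) x)
      (fun n => aemeasurable_riem (hX n) _) (aemeasurable_primD hcont hZ (hε m))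
      (hcont.mono fun ω hω => tendsto_riem hω (hε m))
  · filter_upwards [hcont, hint] with ω hω hi
    exact tendsto_primD hω hi hε hε0
  · intro δ hδ η hη
    -- This is the Markov bound for the truncation error: its mean is at most `2C√(ε m)`, whatever
    -- `n ≥ 1`.
    have hlim : Tendsto (fun m => 2 * C * √(ε m) / δ) atTop (𝓝 0) := by
      have := ((Real.continuous_sqrt.tendsto 0).comp hε0).const_mul (2 * C) |>.div_const δ
      simpa using this
    filter_upwards [hlim.eventually_lt_const hη] with m hm
    filter_upwards [eventually_ge_atTop 1] with n hn
    have hn0 : (0 : ℝ) < n := by exact_mod_cast hn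
    have hεn : ⌊ε m * n⌋₊ ≤ n := by
      refine Nat.floor_le_of_le (mul_le_of_le_one_left hn0.le ?_)
      rw [div_le_one (by positivity)]
      linarith [(m.cast_nonneg : (0 : ℝ) ≤ m)]
    set T : Ω → ℝ := fun ω => ∑ k ∈ Finset.Icc 1 ⌊ε m * n⌋₊, |X n ω (gridPoint n k)| / k
    have hT : AEMeasurable (fun ω => ENNReal.ofReal (T ω)) P :=
      (Finset.aemeasurable_fun_sum _ fun k _ => ((hX n k).abs.div_const _)).ennreal_ofReal
    have hTle : ∫⁻ ω, ENNReal.ofReal (T ω) ∂P ≤ ENNReal.ofReal (2 * C * √(ε m)) := by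
      refine (lintegral_sum_abs_div_le (Y := fun k ω => X n ω (gridPoint n k)) hC (n := n)
        (hX n) fun k hk => ?_).trans ?_
      · obtain ⟨h1, h2⟩ := Finset.mem_Icc.1 hk
        exact hmom n k h1 (h2.trans hεn)
      · refine ENNReal.ofReal_le_ofReal ?_
        gcongr
        rw [div_le_iff₀ hn0]
        exact Nat.floor_le (mul_nonneg (hε m).le hn0.le)
    calc P {ω | ENNReal.ofReal δ < edist (riem n 0 (X n ω)) (riem n (ε m) (X n ω))}
        ≤ P {ω | ENNReal.ofReal δ ≤ ENNReal.ofReal (T ω)} := measure_mono fun ω hω =>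
          (le_of_lt hω).trans (edist_riem_zero_le hn (hε m).le (X n ω))
      _ ≤ (∫⁻ ω, ENNReal.ofReal (T ω) ∂P) / ENNReal.ofReal δ :=
          meas_ge_le_lintegral_div hT (by simpa using hδ) ENNReal.ofReal_ne_top
      _ ≤ ENNReal.ofReal (2 * C * √(ε m)) / ENNReal.ofReal δ := by gcongr
      _ = ENNReal.ofReal (2 * C * √(ε m) / δ) := (ENNReal.ofReal_div_of_pos hδ).symm
      _ ≤ ENNReal.ofReal η := ENNReal.ofReal_le_ofReal hm.le

end SkorokhodSpace

/-! ### The Gaussian law of the limit integral at time one. -/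

theorem MeasureTheory.TendstoInDistribution.congr_map_limit {Ω Ω₁ Ω₂ E : Type*} [MeasurableSpace Ω]
    [MeasurableSpace Ω₁] [MeasurableSpace Ω₂] {P : Measure Ω} [IsProbabilityMeasure P]
    {Q₁ : Measure Ω₁} [IsProbabilityMeasure Q₁] {Q₂ : Measure Ω₂} [IsProbabilityMeasure Q₂]
    [MeasurableSpace E] [TopologicalSpace E] [OpensMeasurableSpace E]
    {X : ℕ → Ω → E} {Z₁ : Ω₁ → E} {Z₂ : Ω₂ → E}
    (h : TendstoInDistribution X atTop Z₁ (fun _ => P) Q₁) (hZ₂ : AEMeasurable Z₂ Q₂)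
    (hmap : Q₁.map Z₁ = Q₂.map Z₂) : TendstoInDistribution X atTop Z₂ (fun _ => P) Q₂ where
  forall_aemeasurable := h.forall_aemeasurable
  aemeasurable_limit := hZ₂
  tendsto := by
    have h' := h.tendsto
    have : (⟨Q₁.map Z₁, Measure.isProbabilityMeasure_map h.aemeasurable_limit⟩ :
        ProbabilityMeasure E) = ⟨Q₂.map Z₂, Measure.isProbabilityMeasure_map hZ₂⟩ :=
      Subtype.ext hmap
    rwa [this] at h'

/-- The double sum is `n` times the variance of `∑ W(k/n)/k` when `m = n`. Passing from `m` to `m +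
1` adds a row and a column of `m` entries `1/(m+1)` and the same diagonal entry, in all `2 -
1/(m+1)`. -/
theorem sum_sum_min_div_mul (m : ℕ) :
    ∑ j ∈ Finset.Icc 1 m, ∑ k ∈ Finset.Icc 1 m, (min j k : ℝ) / (j * k) =
      2 * m - ∑ i ∈ Finset.range m, 1 / ((i : ℝ) + 1) := by
  induction m with
  | zero => simp
  | succ m ih =>
    have hrow : ∀ j ∈ Finset.Icc 1 m, (min (j : ℝ) ((m + 1 : ℕ) : ℝ)) / (j * ((m + 1 : ℕ) : ℝ)) =
        1 / ((m : ℝ) + 1) := by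
      intro j hj
      obtain ⟨h1, h2⟩ := Finset.mem_Icc.1 hj
      have hj0 : (0 : ℝ) < j := by exact_mod_cast h1
      rw [min_eq_left (by exact_mod_cast h2.trans (Nat.le_succ m))]
      push_cast
      field_simp
    have hcol : ∀ j ∈ Finset.Icc 1 m, (min ((m + 1 : ℕ) : ℝ) (j : ℝ)) / (((m + 1 : ℕ) : ℝ) * j) =
        1 / ((m : ℝ) + 1) := by
      intro j hj
      rw [min_comm, mul_comm, hrow j hj]
    simp_rw [Finset.sum_Icc_succ_top (show 1 ≤ m + 1 by omega)]
    rw [Finset.sum_add_distrib, ih, Finset.sum_congr rfl hrow, Finset.sum_congr rfl hcol,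
      Finset.sum_range_succ, min_self]
    simp only [Finset.sum_const, Nat.card_Icc, nsmul_eq_mul, Nat.add_sub_cancel]
    push_cast
    have : (m : ℝ) + 1 ≠ 0 := by positivity
    field_simp
    ring

namespace ProbabilityTheory

variable {Ω' : Type*} [MeasurableSpace Ω'] {Q : Measure Ω'} {W : ℝ≥0 → Ω' → ℝ}

theorem gaussianReal_zero_eq_map (v : ℝ≥0) :
    gaussianReal 0 v = (gaussianReal 0 1).map (√(v : ℝ) * ·) := by
  rw [gaussianReal_map_const_mul, mul_zero, mul_one]
  congr 1
  ext
  simp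

theorem IsPreBrownianReal.lintegral_enorm_eq (hW : IsPreBrownianReal W Q) (t : ℝ≥0) :
    ∫⁻ ω, ‖W t ω‖ₑ ∂Q = ENNReal.ofReal ((∫ x, |x| ∂gaussianReal 0 1) * √(t : ℝ)) := by
  have h1 : ∫⁻ ω, ‖W t ω‖ₑ ∂Q = ∫⁻ x, ‖x‖ₑ ∂gaussianReal 0 t := by
    rw [← (hW.hasLaw_eval t).map_eq, lintegral_map' (by fun_prop) (hW.aemeasurable t)]
  have hint : Integrable (fun x : ℝ => x) (gaussianReal 0 1) := IsGaussian.integrable_id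
  rw [h1, gaussianReal_zero_eq_map, lintegral_map (by fun_prop) (by fun_prop), mul_comm,
    ENNReal.ofReal_mul (Real.sqrt_nonneg _),
    ofReal_integral_eq_lintegral_ofReal hint.abs (Eventually.of_forall fun _ => abs_nonneg _)]
  simp_rw [enorm_mul]
  rw [lintegral_const_mul _ (by fun_prop), Real.enorm_of_nonneg (Real.sqrt_nonneg _)]
  simp_rw [Real.enorm_eq_ofReal_abs]

/-- The weighted sums `∑_{k ≤ n} W(k/n)/k` of a Brownian motion are centered Gaussian, with an
explicit variance. -/
theorem IsPreBrownianReal.map_sum_div (hW : IsPreBrownianReal W Q) (n : ℕ) :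
    Q.map (fun ω => ∑ k ∈ Finset.Icc 1 n, W (Real.toNNReal ((k : ℝ) / n)) ω / k) =
      gaussianReal 0
        (Real.toNNReal ((2 * n - ∑ i ∈ Finset.range n, 1 / ((i : ℝ) + 1)) / n)) := by
  have := hW.isGaussianProcess.isProbabilityMeasure
  have hG : IsGaussianProcess (fun (k : ℕ) ω => W (Real.toNNReal ((k : ℝ) / n)) ω / k) Q := by
    have h := (hW.isGaussianProcess.comp_right (fun k : ℕ => Real.toNNReal ((k : ℝ) / n))).smul
      (fun k : ℕ => ((k : ℝ)⁻¹))
    have heq : (fun (k : ℕ) ω => W (Real.toNNReal ((k : ℝ) / n)) ω / k) =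
        fun (k : ℕ) ω => ((k : ℝ)⁻¹) • W (Real.toNNReal ((k : ℝ) / n)) ω := by
      funext k ω
      rw [smul_eq_mul, div_eq_inv_mul]
    rw [heq]
    exact h
  have hL := hG.hasGaussianLaw_fun_sum (I := Finset.Icc 1 n)
  rw [hL.map_eq_gaussianReal]
  congr 1
  · rw [integral_finsetSum _ fun k _ => (hG.hasGaussianLaw_eval k).integrable]
    refine Finset.sum_eq_zero fun k _ => ?_
    rw [integral_div, hW.integral_eval, zero_div]
  · congr 1
    rw [← covariance_self hL.aemeasurable, covariance_fun_sum_fun_sum'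
      (fun k _ => (hG.hasGaussianLaw_eval k).memLp_two)
      (fun k _ => (hG.hasGaussianLaw_eval k).memLp_two), ← sum_sum_min_div_mul, Finset.sum_div]
    refine Finset.sum_congr rfl fun j _ => ?_
    rw [Finset.sum_div]
    refine Finset.sum_congr rfl fun k _ => ?_
    have hn : (0 : ℝ) ≤ n := n.cast_nonneg
    simp_rw [div_eq_mul_inv (W _ _)]
    rw [covariance_mul_const_left, covariance_mul_const_right, hW.covariance_fun_eval,
      NNReal.coe_min, Real.coe_toNNReal _ (by positivity), Real.coe_toNNReal _ (by positivity),
      min_div_div_right hn]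
    simp only [div_eq_mul_inv, mul_inv]
    ring

end ProbabilityTheory

namespace SkorokhodSpace

variable {Ω' : Type*} [MeasurableSpace Ω'] {Q : Measure Ω'}
  {W : ℝ≥0 → Ω' → ℝ} {Z : Ω' → SkorokhodSpace}

theorem ae_continuous_of_isBrownianReal (hW : IsBrownianReal W Q)
    (hZW : ∀ᵐ ω ∂Q, ∀ t, Z ω t = W (Real.toNNReal t) ω) : ∀ᵐ ω ∂Q, Continuous (Z ω) := by
  filter_upwards [hW.cont, hZW] with ω h1 h2
  rw [show (Z ω : unitInterval → ℝ) = fun t : unitInterval => W (Real.toNNReal t) ω from funext h2]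
  exact h1.comp (continuous_real_toNNReal.comp continuous_subtype_val)

theorem aemeasurable_eval_of_isBrownianReal (hW : IsBrownianReal W Q)
    (hZW : ∀ᵐ ω ∂Q, ∀ t, Z ω t = W (Real.toNNReal t) ω) (t : unitInterval) :
    AEMeasurable (fun ω => Z ω t) Q :=
  (hW.aemeasurable (Real.toNNReal t)).congr (hZW.mono fun _ h => (h t).symm)

theorem lintegral_enorm_of_isBrownianReal (hW : IsBrownianReal W Q)
    (hZW : ∀ᵐ ω ∂Q, ∀ t, Z ω t = W (Real.toNNReal t) ω) (t : unitInterval) :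
    ∫⁻ ω, ‖Z ω t‖ₑ ∂Q = ENNReal.ofReal ((∫ x, |x| ∂gaussianReal 0 1) * √(t : ℝ)) := by
  rw [← Real.coe_toNNReal t t.2.1, ← hW.lintegral_enorm_eq]
  refine lintegral_congr_ae (hZW.mono fun ω h => ?_)
  simp only [h]

theorem ae_intervalIntegrable_of_isBrownianReal (hW : IsBrownianReal W Q)
    (hZW : ∀ᵐ ω ∂Q, ∀ t, Z ω t = W (Real.toNNReal t) ω) :
    ∀ᵐ ω ∂Q, IntervalIntegrable
      (fun s : ℝ => Set.IccExtend zero_le_one (Z ω) s / s) volume 0 1 :=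
  ae_intervalIntegrable_div (ae_continuous_of_isBrownianReal hW hZW)
    (aemeasurable_eval_of_isBrownianReal hW hZW) (integral_nonneg fun _ => abs_nonneg _)
    fun t => (lintegral_enorm_of_isBrownianReal hW hZW t).le

/-- For a Brownian motion `W`, the integral `∫_0^1 W(s)/s ds` has law `N(0, 2)`. -/
theorem map_primD_zero_one [IsProbabilityMeasure Q] (hW : IsBrownianReal W Q)
    (hZW : ∀ᵐ ω ∂Q, ∀ t, Z ω t = W (Real.toNNReal t) ω) (hZ : AEMeasurable Z Q) :
    Q.map (fun ω => primD 0 (Z ω) 1) = (gaussianReal 0 1).map (√2 * ·) := by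
  -- The convergence theorem is applied to the constant sequence `Z`: the Riemann sums of the
  -- Brownian path itself converge in law to the integral. Their Gaussian laws also converge to that
  -- of `√2 N(0,1)`, and limits in law are unique.
  have h1 := (tendstoInDistribution_riem_zero (P := Q) (Q := Q) (X := fun _ => Z) (Z := Z)
    (tendstoInDistribution_const hZ) (ae_continuous_of_isBrownianReal hW hZW)
    (aemeasurable_eval_of_isBrownianReal hW hZW) (ae_intervalIntegrable_of_isBrownianReal hW hZW)
    (fun n k => aemeasurable_eval_of_isBrownianReal hW hZW _)
    (integral_nonneg fun _ => abs_nonneg _) (fun n k _ hk => by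
      rw [← coe_gridPoint hk]
      exact (lintegral_enorm_of_isBrownianReal hW hZW _).le)).continuous_comp continuous_eval_one
  set v : ℕ → ℝ≥0 := fun n =>
    Real.toNNReal ((2 * n - ∑ i ∈ Finset.range n, 1 / ((i : ℝ) + 1)) / n) with hv
  have hlaw : ∀ n, Q.map (fun ω => riem n 0 (Z ω) 1) = (gaussianReal 0 1).map (√(v n : ℝ) * ·) := by
    intro n
    rw [← gaussianReal_zero_eq_map, hv, ← hW.map_sum_div]
    refine Measure.map_congr ?_
    filter_upwards [hZW] with ω hω
    change wsum n 0 (Z ω) ⌊(n : ℝ) * ((1 : unitInterval) : ℝ)⌋₊ = _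
    rw [Set.Icc.coe_one, mul_one, Nat.floor_natCast]
    rcases Nat.eq_zero_or_pos n with rfl | hn
    · simp [wsum]
    · rw [wsum_zero hn]
      refine Finset.sum_congr rfl fun k hk => ?_
      rw [hω, coe_gridPoint (Finset.mem_Icc.1 hk).2]
  have hvlim : Tendsto (fun n => √(v n : ℝ)) atTop (𝓝 √2) := by
    -- `H_n / n` is a Cesàro mean of `1 / (i + 1)`, hence tends to zero.
    have hc := (tendsto_one_div_add_atTop_nhds_zero_nat (𝕜 := ℝ)).cesaro
    have h3 : Tendsto (fun n : ℕ => (2 * n - ∑ i ∈ Finset.range n, 1 / ((i : ℝ) + 1)) / n) atTop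
        (𝓝 2) := by
      have h4 := tendsto_const_nhds (x := (2 : ℝ)).sub hc
      rw [sub_zero] at h4
      refine h4.congr' ?_
      filter_upwards [eventually_ge_atTop 1] with n hn
      have hn0 : (n : ℝ) ≠ 0 := by positivity
      field_simp
    have h5 := (NNReal.continuous_coe.tendsto _).comp ((continuous_real_toNNReal.tendsto 2).comp h3)
    rw [Real.coe_toNNReal _ zero_le_two] at h5
    exact (Real.continuous_sqrt.tendsto 2).comp h5
  have h2 : TendstoInDistribution (fun n (x : ℝ) => √(v n : ℝ) * x) atTop (√2 * ·)
      (fun _ => gaussianReal 0 1) (gaussianReal 0 1) :=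
    tendstoInDistribution_of_ae_tendsto (fun n => by fun_prop) (by fun_prop)
      (Eventually.of_forall fun x => hvlim.mul_const x)
  have h3 : TendstoInDistribution (fun n ω => riem n 0 (Z ω) 1) atTop (√2 * ·)
      (fun _ => Q) (gaussianReal 0 1) := by
    refine ⟨h1.forall_aemeasurable, by fun_prop, ?_⟩
    refine h2.tendsto.congr fun n => ?_
    exact Subtype.ext (hlaw n).symm
  exact tendstoInDistribution_unique _ h1 h3

end SkorokhodSpace

/-! ### A strong law from first moments and monotonicity. -/

section LawOfLargeNumbers

variable {Ω : Type*} [MeasurableSpace Ω] {P : Measure Ω}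

theorem ae_tendsto_zero_of_summable_lintegral {X : ℕ → Ω → ℝ} (hX : ∀ n, AEMeasurable (X n) P)
    {u : ℕ → ℝ} (hu : Summable u) (h : ∀ n, ∫⁻ ω, ‖X n ω‖ₑ ∂P ≤ ENNReal.ofReal (u n)) :
    ∀ᵐ ω ∂P, Tendsto (fun n => X n ω) atTop (𝓝 0) := by
  have hfin : ∫⁻ ω, ∑' n, ‖X n ω‖ₑ ∂P ≠ ∞ := by
    rw [lintegral_tsum fun n => (hX n).enorm]
    exact ne_top_of_le_ne_top hu.tsum_ofReal_ne_top (ENNReal.tsum_le_tsum h)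
  have hm : AEMeasurable (fun ω => ∑' n, ‖X n ω‖ₑ) P := AEMeasurable.tsum fun n => (hX n).enorm
  filter_upwards [ae_lt_top' hm hfin] with ω hω
  have h0 := ENNReal.tendsto_atTop_zero_of_tsum_ne_top hω.ne
  rw [tendsto_zero_iff_norm_tendsto_zero]
  have := (ENNReal.tendsto_toReal ENNReal.zero_ne_top).comp h0
  simpa [Function.comp_def] using this

/-- A strong law of large numbers for nondecreasing sequences with first moments of the deviations
of order `√n`. -/
theorem ae_tendsto_div_of_monotone_of_lintegral_le {S : ℕ → Ω → ℝ} (hS : ∀ n, AEMeasurable (S n) P)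
    (hmono : ∀ᵐ ω ∂P, Monotone fun n => S n ω) {μ C : ℝ} (hC : 0 ≤ C)
    (hmom : ∀ n : ℕ, 1 ≤ n → ∫⁻ ω, ‖S n ω - n * μ‖ₑ ∂P ≤ ENNReal.ofReal (C * √(n : ℝ))) :
    ∀ᵐ ω ∂P, Tendsto (fun n : ℕ => S n ω / n) atTop (𝓝 μ) := by
  -- Along fourth powers the mean deviation of `S_c / c` is at most `C/√c = C/(n+1)²`, which is
  -- summable, while consecutive ratios still tend to `1`, so monotonicity fills the gaps.
  let c : ℕ → ℕ := fun n => (n + 1) ^ 4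
  have hc : Tendsto c atTop atTop :=
    (tendsto_pow_atTop (by norm_num)).comp (tendsto_add_atTop_nat 1)
  have hsub : ∀ᵐ ω ∂P, Tendsto (fun n => S (c n) ω / c n - μ) atTop (𝓝 0) := by
    refine ae_tendsto_zero_of_summable_lintegral
      (u := fun n : ℕ => C * (1 / ((n : ℝ) + 1) ^ 2))
      (fun n => ((hS _).div_const _).sub_const _) ?_ fun n => ?_
    · refine Summable.mul_left C ?_
      have := (summable_nat_add_iff 1).2 (Real.summable_one_div_nat_pow.2 (one_lt_two))
      simpa using this
    · have hcn : (c n : ℝ) = ((n : ℝ) + 1) ^ 4 := by simp [c]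
      have hpos : (0 : ℝ) < c n := by rw [hcn]; positivity
      have hsq : √(c n : ℝ) = ((n : ℝ) + 1) ^ 2 := by
        rw [hcn, show ((n : ℝ) + 1) ^ 4 = (((n : ℝ) + 1) ^ 2) ^ 2 by ring,
          Real.sqrt_sq (by positivity)]
      have h1 : ∀ ω, ‖S (c n) ω / c n - μ‖ₑ =
          ‖S (c n) ω - c n * μ‖ₑ * ENNReal.ofReal (1 / (c n : ℝ)) := by
        intro ω
        rw [show S (c n) ω / c n - μ = (S (c n) ω - c n * μ) * (1 / (c n : ℝ)) by field_simp,
          enorm_mul, Real.enorm_of_nonneg (r := 1 / (c n : ℝ)) (by positivity)]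
      simp_rw [h1]
      rw [lintegral_mul_const'' _ ((hS _).sub_const _).enorm]
      calc _ ≤ ENNReal.ofReal (C * √(c n : ℝ)) * ENNReal.ofReal (1 / (c n : ℝ)) := by
            gcongr
            exact hmom _ (Nat.one_le_pow _ _ (by omega))
        _ = ENNReal.ofReal (C * (1 / ((n : ℝ) + 1) ^ 2)) := by
            rw [← ENNReal.ofReal_mul (by positivity), hsq, hcn]
            congr 1
            field_simp
  filter_upwards [hmono, hsub] with ω h1 h2
  refine tendsto_div_of_monotone_of_exists_subseq_tendsto_div _ _ h1 fun a ha => ⟨c, ?_, hc, ?_⟩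
  · have hlim : Tendsto (fun n : ℕ => (1 + 1 / ((n : ℝ) + 1)) ^ 4) atTop (𝓝 1) := by
      have := ((tendsto_one_div_add_atTop_nhds_zero_nat (𝕜 := ℝ)).const_add 1).pow 4
      simpa using this
    filter_upwards [hlim.eventually_lt_const ha] with n hn
    simp only [c]
    push_cast
    calc ((n : ℝ) + 1 + 1) ^ 4 = (1 + 1 / ((n : ℝ) + 1)) ^ 4 * ((n : ℝ) + 1) ^ 4 := by
          rw [← mul_pow]; congr 1; field_simp
      _ ≤ a * ((n : ℝ) + 1) ^ 4 := by gcongr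
  · simpa using h2.add_const μ

end LawOfLargeNumbers

/-! ### Linearizing the logarithm. -/

/-- The linearization error of the logarithm at `1` is `o(y - 1)`. -/
theorem eventually_abs_log_sub_le {κ : ℝ} (hκ : 0 < κ) :
    ∀ᶠ y in 𝓝 (1 : ℝ), |Real.log y - (y - 1)| ≤ κ * |y - 1| := by
  have h := (Real.hasDerivAt_log one_ne_zero).isLittleO
  filter_upwards [h.def hκ] with y hy
  simpa using hy

/-- If `b k → 1` almost surely, the linearization errors of `log (b k)` are negligible in
probability against the normalized sums of `|b k - 1|`, when these are bounded in mean. -/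
theorem eventually_measure_sum_log_error_le {Ω : Type*} [MeasurableSpace Ω] {P : Measure Ω}
    [IsProbabilityMeasure P] {b : ℕ → Ω → ℝ} (hb : ∀ k, AEMeasurable (b k) P)
    (hlim : ∀ᵐ ω ∂P, Tendsto (fun k => b k ω) atTop (𝓝 1)) {a : ℕ → ℝ} (ha : ∀ n, 0 ≤ a n)
    (ha0 : Tendsto a atTop (𝓝 0)) {C : ℝ} (hC : 0 ≤ C)
    (hmom : ∀ᶠ n in atTop, ∫⁻ ω, ENNReal.ofReal (a n * ∑ k ∈ Finset.Icc 1 n, |b k ω - 1|) ∂P ≤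
      ENNReal.ofReal C) {δ η : ℝ} (hδ : 0 < δ) (hη : 0 < η) :
    ∀ᶠ n in atTop, P {ω | δ < a n * ∑ k ∈ Finset.Icc 1 n, |Real.log (b k ω) - (b k ω - 1)|} ≤
      ENNReal.ofReal η := by
  -- `κ` makes the Markov bound for `κ M_n ≥ δ / 2` at most `η / 2`; the `C + 1` in the witness
  -- covers `C = 0`.
  obtain ⟨κ, hκ, hκη⟩ : ∃ κ : ℝ, 0 < κ ∧ C / (δ / 2 / κ) ≤ η / 2 := by
    refine ⟨η * δ / (4 * (C + 1)), by positivity, ?_⟩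
    rw [div_div_eq_mul_div, div_le_iff₀ (by positivity), mul_div_assoc', div_le_iff₀ (by positivity)]
    nlinarith [mul_pos hη hδ]
  -- `d k` is the excess of the error over `κ|b k - 1|`. On almost every path it vanishes for large
  -- `k`, so `V n` is eventually `a n` times a fixed finite sum and tends to zero; `κ M n` bounds
  -- the rest.
  let d : ℕ → Ω → ℝ := fun k ω => max (|Real.log (b k ω) - (b k ω - 1)| - κ * |b k ω - 1|) 0
  let V : ℕ → Ω → ℝ := fun n ω => a n * ∑ k ∈ Finset.Icc 1 n, d k ω
  let M : ℕ → Ω → ℝ := fun n ω => a n * ∑ k ∈ Finset.Icc 1 n, |b k ω - 1|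
  have hM : ∀ n, AEMeasurable (M n) P := fun n =>
    (Finset.aemeasurable_fun_sum _ fun k _ => ((hb k).sub_const _).abs).const_mul _
  have hV : ∀ n, AEMeasurable (V n) P := fun n =>
    (Finset.aemeasurable_fun_sum _ fun k _ =>
      (((Real.measurable_log.comp_aemeasurable (hb k)).sub ((hb k).sub_const _)).abs.sub
        (((hb k).sub_const _).abs.const_mul _)).max aemeasurable_const).const_mul _
  have hVlim : ∀ᵐ ω ∂P, Tendsto (fun n => V n ω) atTop (𝓝 0) := by
    filter_upwards [hlim] with ω hω
    obtain ⟨K, hK⟩ := eventually_atTop.1 (hω.eventually (eventually_abs_log_sub_le hκ))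
    have hd : ∀ k ≥ K, d k ω = 0 := fun k hk => max_eq_right (by linarith [hK k hk])
    have hbound : Tendsto (fun n => a n * ∑ k ∈ Finset.range K, d k ω) atTop (𝓝 0) := by
      simpa using ha0.mul_const (∑ k ∈ Finset.range K, d k ω)
    refine squeeze_zero (fun n => mul_nonneg (ha n)
      (Finset.sum_nonneg fun k _ => le_max_right _ _)) (fun n => ?_) hbound
    refine mul_le_mul_of_nonneg_left ?_ (ha n)
    rw [← Finset.sum_filter_add_sum_filter_not (Finset.Icc 1 n) (· < K),
      Finset.sum_eq_zero (s := (Finset.Icc 1 n).filter (¬ · < K))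
        fun k hk => hd k (not_lt.1 (Finset.mem_filter.1 hk).2), add_zero]
    exact Finset.sum_le_sum_of_subset_of_nonneg
      (fun k hk => Finset.mem_range.2 (Finset.mem_filter.1 hk).2) fun k _ _ => le_max_right _ _
  have hVm := tendstoInMeasure_of_tendsto_ae (fun n => (hV n).aestronglyMeasurable) hVlim
  have hVm' := (tendstoInMeasure_iff_norm.1 hVm (δ / 2) (half_pos hδ)).eventually_le_const
    (ENNReal.ofReal_pos.2 (half_pos hη))
  filter_upwards [hVm', hmom] with n hn hmn
  have hκ' : 0 < δ / 2 / κ := by positivity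
  have hMn : P {ω | ENNReal.ofReal (δ / 2 / κ) ≤ ENNReal.ofReal (M n ω)} ≤
      ENNReal.ofReal (η / 2) := by
    refine (meas_ge_le_lintegral_div (hM n).ennreal_ofReal (by simpa using hκ')
      ENNReal.ofReal_ne_top).trans ?_
    calc _ ≤ ENNReal.ofReal C / ENNReal.ofReal (δ / 2 / κ) := by gcongr
      _ = ENNReal.ofReal (C / (δ / 2 / κ)) := (ENNReal.ofReal_div_of_pos hκ').symm
      _ ≤ _ := ENNReal.ofReal_le_ofReal hκη
  calc _ ≤ P ({ω | δ / 2 ≤ ‖V n ω - 0‖} ∪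
        {ω | ENNReal.ofReal (δ / 2 / κ) ≤ ENNReal.ofReal (M n ω)}) := by
        refine measure_mono fun ω hω => ?_
        by_contra hnot
        simp only [Set.mem_union, Set.mem_ofPred_eq, not_or, not_le, sub_zero] at hnot
        obtain ⟨h1, h2⟩ := hnot
        have h1' := (le_abs_self _).trans_lt h1
        have h2' : M n ω < δ / 2 / κ := (ENNReal.ofReal_lt_ofReal_iff hκ').1 h2
        rw [lt_div_iff₀ hκ] at h2'
        have h3 : a n * ∑ k ∈ Finset.Icc 1 n, |Real.log (b k ω) - (b k ω - 1)| ≤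
            V n ω + M n ω * κ := by
          simp only [V, M]
          rw [mul_assoc, ← mul_add, Finset.sum_mul, ← Finset.sum_add_distrib]
          refine mul_le_mul_of_nonneg_left (Finset.sum_le_sum fun k _ => ?_) (ha n)
          have := le_max_left (|Real.log (b k ω) - (b k ω - 1)| - κ * |b k ω - 1|) 0
          simp only [d]
          linarith
        have hω' : δ < _ := hω
        linarith
    _ ≤ ENNReal.ofReal (η / 2) + ENNReal.ofReal (η / 2) :=
        (measure_union_le _ _).trans (add_le_add hn hMn)
    _ = ENNReal.ofReal η := by
        rw [← ENNReal.ofReal_add (by positivity) (by positivity), add_halves]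

/-! ### The logarithm of the product process. -/

namespace SkorokhodSpace

theorem aemeasurable_rescaledProcess {Ω : Type*} [MeasurableSpace Ω] {P : Measure Ω}
    {S : ℕ → Ω → ℝ} (hS : ∀ k, Measurable (S k)) (μ σ : ℝ) (n : ℕ) (t : unitInterval) :
    AEMeasurable (fun ω => rescaledProcess S μ σ n ω t) P :=
  (((hS _).sub_const _).div_const _).aemeasurable

theorem rescaledProcess_gridPoint {Ω : Type*} (S : ℕ → Ω → ℝ) (μ σ : ℝ) {n k : ℕ} (hk : 1 ≤ k)
    (hkn : k ≤ n) (ω : Ω) :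
    rescaledProcess S μ σ n ω (gridPoint n k) = (S k ω - k * μ) / (σ * √(n : ℝ)) := by
  have hn : (n : ℝ) ≠ 0 := by exact_mod_cast (by omega : n ≠ 0)
  rw [rescaledProcess, coe_gridPoint hkn, mul_div_cancel₀ _ hn, Nat.floor_natCast]

/-- The logarithm of the product process. -/
noncomputable def logProduct {Ω : Type*} (S : ℕ → Ω → ℝ) (μ γ : ℝ) (n : ℕ) (ω : Ω) :
    SkorokhodSpace :=
  stepD n fun j => γ / √(n : ℝ) * ∑ k ∈ Finset.Icc 1 j, Real.log (S k ω / (k * μ))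

theorem expD_logProduct_apply {Ω : Type*} {S : ℕ → Ω → ℝ} {μ : ℝ} (hμ : 0 < μ) (γ : ℝ) (n : ℕ)
    {ω : Ω} (hpos : ∀ k, 1 ≤ k → 0 < S k ω) (t : unitInterval) :
    expD (logProduct S μ γ n ω) t = productProcess S μ γ n ω t := by
  have hfac : ∀ k ∈ Finset.Icc 1 ⌊(n : ℝ) * t⌋₊, 0 < S k ω / (k * μ) := fun k hk => by
    have hk1 := (Finset.mem_Icc.1 hk).1
    have hk0 : (0 : ℝ) < k := by exact_mod_cast hk1
    have := hpos k hk1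
    positivity
  rw [productProcess, Real.rpow_def_of_pos (Finset.prod_pos hfac),
    Real.log_prod fun k hk => (hfac k hk).ne', mul_comm]
  rfl

variable {Ω : Type*} [MeasurableSpace Ω] {P : Measure Ω}

theorem aemeasurable_logProduct_coeff {S : ℕ → Ω → ℝ} (hS : ∀ k, Measurable (S k)) (μ γ : ℝ)
    (n j : ℕ) : AEMeasurable
      (fun ω => γ / √(n : ℝ) * ∑ k ∈ Finset.Icc 1 j, Real.log (S k ω / (k * μ))) P :=
  (Finset.aemeasurable_fun_sum _ fun k _ =>
    (Real.measurable_log.comp ((hS k).div_const _)).aemeasurable).const_mul _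

/-- The logarithm of the product process differs from the weighted Riemann sum of the rescaled
process by the accumulated linearization error of the logarithm. -/
theorem edist_logProduct_riem_le {Ω : Type*} {S : ℕ → Ω → ℝ} {μ σ : ℝ} (hμ : 0 < μ) (hσ : 0 < σ)
    {n : ℕ} (hn : 1 ≤ n) {ω : Ω} {x : SkorokhodSpace} (hx : ∀ t, x t = rescaledProcess S μ σ n ω t) :
    edist (logProduct S μ (μ / σ) n ω) (riem n 0 x) ≤ ENNReal.ofReal (μ / σ / √(n : ℝ) *
      ∑ k ∈ Finset.Icc 1 n, |Real.log (S k ω / (k * μ)) - (S k ω / (k * μ) - 1)|) := by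
  have hn0 : (0 : ℝ) < √(n : ℝ) := Real.sqrt_pos.2 (by exact_mod_cast hn)
  refine edist_le_ofReal fun t => ?_
  change |μ / σ / √(n : ℝ) * ∑ k ∈ Finset.Icc 1 ⌊(n : ℝ) * t⌋₊, Real.log (S k ω / (k * μ)) -
    wsum n 0 x ⌊(n : ℝ) * t⌋₊| ≤ _
  -- This identity is what fixes the exponent `γ = μ / σ`.
  have hterm : ∀ k ∈ Finset.Icc 1 ⌊(n : ℝ) * t⌋₊,
      x (gridPoint n k) / k = μ / σ / √(n : ℝ) * (S k ω / (k * μ) - 1) := by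
    intro k hk
    obtain ⟨h1, h2⟩ := Finset.mem_Icc.1 hk
    have hk0 : (0 : ℝ) < k := by exact_mod_cast h1
    rw [hx, rescaledProcess_gridPoint S μ σ h1 (h2.trans (floor_mul_le n t))]
    field_simp
  rw [wsum_zero hn, Finset.sum_congr rfl hterm, ← Finset.mul_sum, ← mul_sub,
    ← Finset.sum_sub_distrib, abs_mul, abs_of_nonneg (by positivity)]
  refine mul_le_mul_of_nonneg_left ((Finset.abs_sum_le_sum_abs _ _).trans ?_) (by positivity)
  exact Finset.sum_le_sum_of_subset_of_nonneg
    (Finset.Icc_subset_Icc_right (floor_mul_le n t)) fun _ _ _ => abs_nonneg _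

/-- The Riemann sums of the rescaled process converge to the integral, and the logarithm differs
from them by a linearization error that is negligible in probability. -/
theorem tendstoInDistribution_logProduct [IsProbabilityMeasure P] {Ω' : Type*} [MeasurableSpace Ω']
    {Q : Measure Ω'} [IsProbabilityMeasure Q] {S : ℕ → Ω → ℝ} (hS : ∀ k, Measurable (S k))
    (hmono : ∀ᵐ ω ∂P, Monotone fun n => S n ω) {μ σ : ℝ} (hμ : 0 < μ) (hσ : 0 < σ)
    {X : ℕ → Ω → SkorokhodSpace} (hX : ∀ n, ∀ᵐ ω ∂P, ∀ t, X n ω t = rescaledProcess S μ σ n ω t)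
    {W : ℝ≥0 → Ω' → ℝ} (hW : IsBrownianReal W Q) {Z : Ω' → SkorokhodSpace}
    (hZ : ∀ᵐ ω ∂Q, ∀ t, Z ω t = W (Real.toNNReal t) ω)
    (hXZ : TendstoInDistribution X atTop Z (fun _ => P) Q) {C : ℝ} (hC : 0 ≤ C)
    (hmom : ∀ n : ℕ, 1 ≤ n → ∫⁻ ω, ‖S n ω - n * μ‖ₑ ∂P ≤ ENNReal.ofReal (C * √(n : ℝ))) :
    TendstoInDistribution (logProduct S μ (μ / σ)) atTop (fun ω => primD 0 (Z ω))
      (fun _ => P) Q := by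
  have hXm : ∀ n t, AEMeasurable (fun ω => X n ω t) P := fun n t =>
    (aemeasurable_rescaledProcess hS μ σ n t).congr ((hX n).mono fun _ h => (h t).symm)
  have hgrid : ∀ n k : ℕ, 1 ≤ k → k ≤ n →
      ∫⁻ ω, ‖X n ω (gridPoint n k)‖ₑ ∂P ≤ ENNReal.ofReal (C / σ * √((k : ℝ) / n)) := by
    intro n k hk hkn
    have hn0 : (0 : ℝ) < √(n : ℝ) := Real.sqrt_pos.2 (by exact_mod_cast hk.trans hkn)
    calc ∫⁻ ω, ‖X n ω (gridPoint n k)‖ₑ ∂P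
        = ∫⁻ ω, ‖S k ω - k * μ‖ₑ * ENNReal.ofReal (1 / (σ * √(n : ℝ))) ∂P := by
          refine lintegral_congr_ae ((hX n).mono fun ω h => ?_)
          simp only [h]
          rw [rescaledProcess_gridPoint S μ σ hk hkn, div_eq_mul_one_div, enorm_mul,
            Real.enorm_of_nonneg (r := 1 / (σ * √(n : ℝ))) (by positivity)]
      _ = (∫⁻ ω, ‖S k ω - k * μ‖ₑ ∂P) * ENNReal.ofReal (1 / (σ * √(n : ℝ))) :=
          lintegral_mul_const'' _ ((hS k).sub_const _).aemeasurable.enorm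
      _ ≤ ENNReal.ofReal (C * √(k : ℝ)) * ENNReal.ofReal (1 / (σ * √(n : ℝ))) := by
          gcongr
          exact hmom k hk
      _ = _ := by
          rw [← ENNReal.ofReal_mul (by positivity), Real.sqrt_div k.cast_nonneg]
          congr 1
          field_simp
  have hcont := ae_continuous_of_isBrownianReal hW hZ
  have hZm := aemeasurable_eval_of_isBrownianReal hW hZ
  have hint := ae_intervalIntegrable_of_isBrownianReal hW hZ
  have hriem := tendstoInDistribution_riem_zero hXZ hcont hZm hint
    (fun n k => hXm n _) (div_nonneg hC hσ.le) hgrid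
  -- The auxiliary index `m` plays no role here: this is Slutsky's argument.
  refine tendstoInDistribution_of_converging_together (A := fun _ n ω => riem n 0 (X n ω))
    (B := fun _ ω => primD 0 (Z ω)) (fun _ => hriem)
    (fun n => aemeasurable_stepD n fun j => aemeasurable_logProduct_coeff hS _ _ n j)
    hriem.aemeasurable_limit (Eventually.of_forall fun ω => tendsto_const_nhds)
    fun δ hδ η hη => Eventually.of_forall fun _ => ?_
  have ha0 : Tendsto (fun n : ℕ => μ / σ / √(n : ℝ)) atTop (𝓝 0) :=
    (Real.tendsto_sqrt_atTop.comp tendsto_natCast_atTop_atTop).const_div_atTop _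
  have hlim : ∀ᵐ ω ∂P, Tendsto (fun k : ℕ => S k ω / (k * μ)) atTop (𝓝 1) := by
    filter_upwards [ae_tendsto_div_of_monotone_of_lintegral_le
      (fun n => (hS n).aemeasurable) hmono hC hmom] with ω hω
    have := hω.div_const μ
    rw [div_self hμ.ne'] at this
    exact this.congr fun k => div_div _ _ _
  have hlog := eventually_measure_sum_log_error_le (P := P)
    (b := fun k ω => S k ω / (k * μ)) (a := fun n => μ / σ / √(n : ℝ))
    (fun k => ((hS k).div_const _).aemeasurable) hlim (fun n => by positivity) ha0
    (C := 2 * (C / σ)) (by positivity) ?_ hδ hη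
  · filter_upwards [hlog, eventually_ge_atTop 1] with n hn hn1
    refine (measure_mono_ae ?_).trans hn
    filter_upwards [hX n] with ω hω hlt
    exact ENNReal.ofReal_lt_ofReal_iff_of_nonneg hδ.le |>.1
      (lt_of_lt_of_le hlt (edist_logProduct_riem_le hμ hσ hn1 hω))
  -- The normalized sum of `|S_k/(kμ) - 1|` equals `∑ |W_n(k/n)|/k` almost surely, whose mean is at
  -- most `2C/σ`.
  · filter_upwards [eventually_ge_atTop 1] with n hn
    have hn0 : (0 : ℝ) < n := by exact_mod_cast hn
    have h := lintegral_sum_abs_div_le (P := P) (m := n) (n := n)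
      (Y := fun k ω => X n ω (gridPoint n k)) (div_nonneg hC hσ.le) (fun k => hXm n _)
      fun k hk => hgrid n k (Finset.mem_Icc.1 hk).1 (Finset.mem_Icc.1 hk).2
    rw [div_self hn0.ne', Real.sqrt_one, mul_one] at h
    refine le_trans (le_of_eq (lintegral_congr_ae ?_)) h
    filter_upwards [hX n] with ω hω
    rw [Finset.mul_sum]
    congr 1
    refine Finset.sum_congr rfl fun k hk => ?_
    obtain ⟨h1, h2⟩ := Finset.mem_Icc.1 hk
    have hk0 : (0 : ℝ) < k := by exact_mod_cast h1
    have hs0 : 0 < √(n : ℝ) := Real.sqrt_pos.2 hn0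
    rw [hω, rescaledProcess_gridPoint S μ σ h1 h2,
      show S k ω / (k * μ) - 1 = (S k ω - k * μ) / (k * μ) by field_simp, abs_div, abs_div,
      abs_of_pos (mul_pos hk0 hμ), abs_of_pos (mul_pos hσ hs0)]
    field_simp

end SkorokhodSpace

/-! ### The main theorem. -/

open SkorokhodSpace in
theorem theorem1p1 {Ω Ω' : Type*} [MeasurableSpace Ω] [MeasurableSpace Ω']
    (P : Measure Ω) [IsProbabilityMeasure P] (Q : Measure Ω') [IsProbabilityMeasure Q]
    -- the sequence `S_1 ≤ S_2 ≤ …` of positive random variables, with the convention `S_0 = 0`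
    (S : ℕ → Ω → ℝ) (hS_meas : ∀ k, Measurable (S k)) (hS_zero : ∀ ω, S 0 ω = 0)
    (hS_pos : ∀ k, 1 ≤ k → ∀ᵐ ω ∂P, 0 < S k ω)
    (hS_mono : ∀ k, 1 ≤ k → ∀ᵐ ω ∂P, S k ω ≤ S (k + 1) ω)
    -- the standard Wiener process
    (W : ℝ≥0 → Ω' → ℝ) (hW : IsBrownianReal W Q)
    (μ σ : ℝ) (hμ : 0 < μ) (hσ : 0 < σ)
    (h_conv : ConvergesInDistributionInD (rescaledProcess S μ σ)
      (fun ω (t : unitInterval) => W (Real.toNNReal t) ω) P Q)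
    (h_sup : ∃ C : ℝ, ∀ n : ℕ, 1 ≤ n →
      Integrable (S n) P ∧ (∫ ω, |S n ω - (n : ℝ) * μ| ∂P) / √(n : ℝ) ≤ C) :
    -- the limit integrals `∫_0^t W(x)/x dx` make sense
    (∀ᵐ ω ∂Q, IntervalIntegrable (fun x : ℝ => W (Real.toNNReal x) ω / x) volume 0 1) ∧
    ConvergesInDistributionInD (productProcess S μ (μ / σ))
      (fun ω (t : unitInterval) => Real.exp (∫ x in (0 : ℝ)..t, W (Real.toNNReal x) ω / x)) P Q ∧
    TendstoInDistribution
      (fun (n : ℕ) ω => (∏ k ∈ Finset.Icc 1 n, S k ω / ((k : ℝ) * μ)) ^ ((μ / σ) / √(n : ℝ)))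
      atTop (fun x : ℝ => Real.exp (√2 * x)) (fun _ => P) (gaussianReal 0 1) := by
  obtain ⟨X, Z, hX, hZ, hXZ⟩ := h_conv
  obtain ⟨C, hCbound⟩ := h_sup
  have hpos : ∀ᵐ ω ∂P, ∀ k, 1 ≤ k → 0 < S k ω :=
    ae_all_iff.2 fun k => eventually_imp_distrib_left.2 (hS_pos k)
  have hmono : ∀ᵐ ω ∂P, Monotone fun n => S n ω := by
    have hstep : ∀ᵐ ω ∂P, ∀ k, 1 ≤ k → S k ω ≤ S (k + 1) ω :=
      ae_all_iff.2 fun k => eventually_imp_distrib_left.2 (hS_mono k)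
    filter_upwards [hpos, hstep] with ω h1 h2
    refine monotone_nat_of_le_succ fun k => ?_
    rcases Nat.eq_zero_or_pos k with rfl | hk
    · rw [hS_zero]
      exact (h1 1 le_rfl).le
    · exact h2 k hk
  have hC : 0 ≤ C := (div_nonneg (integral_nonneg fun _ => abs_nonneg _)
    (Real.sqrt_nonneg _)).trans (hCbound 1 le_rfl).2
  -- Integrability of `S n` is what lets the Bochner integral bound the lower integral.
  have hmom : ∀ n : ℕ, 1 ≤ n →
      ∫⁻ ω, ‖S n ω - n * μ‖ₑ ∂P ≤ ENNReal.ofReal (C * √(n : ℝ)) := by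
    intro n hn
    obtain ⟨hi, hb⟩ := hCbound n hn
    have hn0 : (0 : ℝ) < √(n : ℝ) := Real.sqrt_pos.2 (by exact_mod_cast hn)
    rw [div_le_iff₀ hn0] at hb
    refine le_trans (le_of_eq ?_) (ENNReal.ofReal_le_ofReal hb)
    rw [ofReal_integral_eq_lintegral_ofReal (f := fun ω => |S n ω - n * μ|)
      (hi.sub (integrable_const _)).abs (Eventually.of_forall fun _ => abs_nonneg _)]
    simp_rw [Real.enorm_eq_ofReal_abs]
  have hcont := ae_continuous_of_isBrownianReal hW hZ
  have hZm := aemeasurable_eval_of_isBrownianReal hW hZ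
  have hint := ae_intervalIntegrable_of_isBrownianReal hW hZ
  have hext : ∀ᵐ ω ∂Q, ∀ s ∈ Set.Icc (0 : ℝ) 1,
      Set.IccExtend zero_le_one (Z ω) s / s = W (Real.toNNReal s) ω / s := by
    filter_upwards [hZ] with ω hω s hs
    rw [Set.IccExtend_of_mem _ _ hs, hω]
  have hlog := tendstoInDistribution_logProduct hS_meas hmono hμ hσ hX hW hZ hXZ hC hmom
  have hexp : TendstoInDistribution (fun n ω => expD (logProduct S μ (μ / σ) n ω)) atTop
      (fun ω => expD (primD 0 (Z ω))) (fun _ => P) Q := by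
    refine hlog.extended_continuous_mapping (h := fun _ => expD) (fun n => ?_)
      (aemeasurable_expD_primD_zero hcont hZm hint) ?_
    · exact aemeasurable_stepD n fun j => Real.measurable_exp.comp_aemeasurable
        (aemeasurable_logProduct_coeff hS_meas μ (μ / σ) n j)
    · filter_upwards [hint] with ω hω
      exact (tendsto_expD (continuous_primD_zero hω)).comp tendsto_snd
  refine ⟨?_, ⟨fun n ω => expD (logProduct S μ (μ / σ) n ω), fun ω => expD (primD 0 (Z ω)),
    fun n => ?_, ?_, hexp⟩, ?_⟩
  · filter_upwards [hint, hext] with ω h1 h2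
    refine h1.congr fun s hs => h2 s ?_
    rw [Set.uIoc_of_le zero_le_one] at hs
    exact Set.Ioc_subset_Icc_self hs
  · filter_upwards [hpos] with ω hω t
    exact expD_logProduct_apply hμ _ n hω t
  · filter_upwards [hint, hext] with ω h1 h2 t
    change Real.exp (primD 0 (Z ω) t) = _
    rw [primD_zero_apply h1]
    congr 1
    refine intervalIntegral.integral_congr fun s hs => h2 s ?_
    rw [Set.uIcc_of_le t.2.1] at hs
    exact ⟨hs.1, hs.2.trans t.2.2⟩
  -- At `t = 1` the floor is `n` itself, so the last claim is the functional limit evaluated there,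
  -- with the limit replaced by a variable of the same law on the Gaussian space.
  · have h1 := hexp.continuous_comp continuous_eval_one
    have hprim : AEMeasurable (fun ω => primD 0 (Z ω) 1) Q :=
      continuous_eval_one.measurable.comp_aemeasurable hlog.aemeasurable_limit
    have h2 := h1.congr_map_limit (Q₂ := gaussianReal 0 1)
      (Z₂ := fun x : ℝ => Real.exp (√2 * x)) (by fun_prop) (by
        have h3 := congrArg (Measure.map Real.exp)
          (map_primD_zero_one hW hZ hXZ.aemeasurable_limit)
        rw [AEMeasurable.map_map_of_aemeasurable Real.measurable_exp.aemeasurable hprim,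
          Measure.map_map Real.measurable_exp (by fun_prop)] at h3
        exact h3)
    refine h2.congr (fun n => ?_) ae_eq_rfl
    filter_upwards [hpos] with ω hω
    have h4 := expD_logProduct_apply hμ (μ / σ) n hω 1
    rw [productProcess, Set.Icc.coe_one, mul_one, Nat.floor_natCast] at h4
    exact h4
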